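/- **Problem (minimal-cost SCC matching).** Let $V$ be a nonempty finite set, $\emptyset\ne I\subsetneq V$, $V'=V\setminus I$, and let $G=(V,E,C)$ be the directed graph with $E=(V\times V)\setminus(I\times I)$ and costs $C\colon E\to\mathbb R$. For a subgraph $H=(V,E_H)$ of $G$ (with the restricted costs) let $\mathrm{SCC}(H[V'])$ be the set of maximal strongly connected components of the subgraph of $H$ induced on $V'$ (single vertices count as strongly connected), let $c_{\max}(H)=\max_{e\in E_H}C(e)$, and let $B(H)$ be the bipartite graph with sides $\mathrm{SCC}(H[V'])$ and $I$ in which a component $Q$ and $i\in I$ are adjacent if and only if there are vertices $q_1,q_2$ of $Q$ with $(q_1,i)\in E_H$ and $(i,q_2)\in E_H$. Find a subgraph $H^*=(V,E^*)$ of $G$ and a matching $M^*$ in $B(H^*)$ with $|M^*|=|\mathrm{SCC}(H^*[V'])|$ such that $c_{\max}(H^*)$ is least among all subgraphs for which such a matching exists. **Algorithm.** Let $M$ be a maximum matching in $B(G)$. While $|M|=|\mathrm{SCC}(G[V'])|$: put $(H^*,M^*):=(G,M)$, delete from $G$ an edge of highest cost in $G$, and let $M$ be a maximum matching in $B(G)$.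 Then return $(H^*,M^*)$. **Theorem.** Whichever highest-cost edges and whichever maximum matchings are chosen, the algorithm is well defined, terminates after at most $|E|$ iterations, and returns a solution $(H^*,M^*)$ of the problem. Moreover, it can be carried out in cubic time in the size of the input graph: there are a constant $c$ and one program for a unit-cost random access machine (with addition, truncated subtraction and comparison of natural numbers, and comparison of two edge costs, as operations) which, on every input with $V=\{0,\dots,n-1\}$, carries out a complete run of the algorithm, that is, writes down the successively deleted edges, the successive matchings and the returned pair $(H^*,M^*)$, and halts after at most $c\,(|V|+|E|)^3$ steps. -/

import Mathlib

namespace SCCMatching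

/-! ## Graphs, strongly connected components, matchings

All graphs here are subgraphs, on the same finite vertex set `V`, of one directed graph with costs.
Such a subgraph is given by its set `E` of edges; its cost function is the restriction to `E`
of the given one. -/

/-- The induced subgraph on `Q` of the graph with edge set `E` is strongly connected: any two
vertices of `Q` are joined by a path of edges that stays in `Q`. -/
def StronglyConnected {V : Type*} (E : Finset (V × V)) (Q : Finset V) : Prop :=
  ∀ u ∈ Q, ∀ v ∈ Q,
    Relation.ReflTransGen (fun a b => (a, b) ∈ E ∧ a ∈ Q ∧ b ∈ Q) u v

open Classical in
/-- The vertex sets of the maximal strongly connected components of the subgraph induced on `W`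
of the graph with edge set `E`. (A maximal component is an induced subgraph, so it is determined
by its vertex set.) -/
noncomputable def sccs {V : Type*} (E : Finset (V × V)) (W : Finset V) : Finset (Finset V) :=
  W.powerset.filter fun Q =>
    Maximal (fun R : Finset V => R.Nonempty ∧ R ⊆ W ∧ StronglyConnected E R) Q

/-- `M` is a matching in the bipartite graph with sides in `A` and `B` and edge set `F`: a set of
edges, no two of which have a common vertex. -/
def IsMatching {A B : Type*} (F M : Finset (A × B)) : Prop :=
  M ⊆ F ∧ ∀ x ∈ M, ∀ y ∈ M, x ≠ y → x.1 ≠ y.1 ∧ x.2 ≠ y.2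

/-- `M` is a matching of the largest size. -/
def IsMaximumMatching {A B : Type*} (F M : Finset (A × B)) : Prop :=
  IsMatching F M ∧ ∀ M', IsMatching F M' → M'.card ≤ M.card

/-- The input: a nonempty proper subset `I` of the vertices, and edge costs. Only the costs of
the pairs outside `I × I` are ever referred to. -/
structure Input (V : Type*) [Fintype V] where
  I : Finset V
  cost : V × V → ℝ
  nonempty : I.Nonempty
  proper : I ≠ Finset.univ

namespace Input

variable {V : Type*} [Fintype V] [DecidableEq V] (P : Input V)

/-- The set `V' = V \ I` of target vertices. -/
def targets : Finset V := Finset.univ \ P.I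

/-- The edge set `(V × V) \ (I × I)` of the input graph `G`. -/
def edges : Finset (V × V) := Finset.univ \ (P.I ×ˢ P.I)

/-- The size of the input graph: its number of vertices plus its number of edges. -/
def size : ℕ := Fintype.card V + P.edges.card

/-- The maximum cost of an edge in `E` (`⊥` if there is no edge). -/
noncomputable def cmax (E : Finset (V × V)) : WithBot ℝ := (E.image P.cost).max

open Classical in
/-- The edges of the bipartite graph between the components of the subgraph induced on `V'` and
the vertices in `I`: a component `Q` is adjacent to `i` if there are edges from `Q` to `i` and
from `i` to `Q`. -/
noncomputable def bip (E : Finset (V × V)) : Finset (Finset V × V) :=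
  (sccs E P.targets ×ˢ P.I).filter fun x =>
    ∃ q₁ ∈ x.1, ∃ q₂ ∈ x.1, (q₁, x.2) ∈ E ∧ (x.2, q₂) ∈ E

/-- `M` is a matching of size `|SCC(H[V'])|` in the bipartite graph of the subgraph `H = (V, E)`
of `G`. -/
def Feasible (E : Finset (V × V)) (M : Finset (Finset V × V)) : Prop :=
  E ⊆ P.edges ∧ IsMatching (P.bip E) M ∧ M.card = (sccs E P.targets).card

/-- Minimal-cost SCC matching: a feasible pair whose subgraph has the least maximum cost. -/
def IsSolution (E : Finset (V × V)) (M : Finset (Finset V × V)) : Prop :=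
  P.Feasible E M ∧ ∀ E' M', P.Feasible E' M' → P.cmax E ≤ P.cmax E'

end Input

/-! ## The algorithm

A transition system: one transition is one iteration of the while loop. Which edge of highest
cost is deleted, and which maximum matching is computed, is left open. -/

/-- The values of the variables `G`, `M` and of the pair `(H*, M*)`, which is undefined at
first. -/
structure AlgState (V : Type*) where
  G : Finset (V × V)
  M : Finset (Finset V × V)
  best : Option (Finset (V × V) × Finset (Finset V × V))

namespace Input

variable {V : Type*} [Fintype V] [DecidableEq V] (P : Input V)

/-- The state in front of the loop. -/
def IsStart (s : AlgState V) : Prop :=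
  s.G = P.edges ∧ IsMaximumMatching (P.bip s.G) s.M ∧ s.best = none

/-- The loop condition `|M| = |SCC(G[V'])|`. -/
def Guard (s : AlgState V) : Prop := s.M.card = (sccs s.G P.targets).card

/-- The loop body deletes `e`: store `(G, M)`, delete the edge `e` of highest cost, compute a
maximum matching. -/
def Body (e : V × V) (s s' : AlgState V) : Prop :=
  e ∈ s.G ∧ (∀ f ∈ s.G, P.cost f ≤ P.cost e) ∧
  s'.G = s.G.erase e ∧ s'.best = some (s.G, s.M) ∧ IsMaximumMatching (P.bip s'.G) s'.M

/-- One iteration of the loop. -/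
def Step (s s' : AlgState V) : Prop := P.Guard s ∧ ∃ e, P.Body e s s'

/-- `σ 0, …, σ T` are the states of a run of the algorithm after `0, …, T` iterations. -/
def IsRun (T : ℕ) (σ : ℕ → AlgState V) : Prop :=
  P.IsStart (σ 0) ∧ ∀ k < T, P.Step (σ k) (σ (k + 1))

end Input

/-! ## Random access machines

Structured programs for a machine with registers and arrays of natural numbers, with addition and
truncated subtraction but no multiplication, and with a read-only table of real numbers, on
which the only operation is the comparison of two entries. -/

/-- Arithmetic expressions; `get a i` is entry `i` of array number `a`. -/
inductive Expr where
  | lit (k : ℕ)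
  | reg (x : ℕ)
  | get (a : ℕ) (i : Expr)
  | add (e₁ e₂ : Expr)
  | sub (e₁ e₂ : Expr)

/-- Tests; `tableLe i j` compares the entries `i` and `j` of the table of reals. -/
inductive Test where
  | le (e₁ e₂ : Expr)
  | tableLe (i j : Expr)
  | neg (b : Test)
  | both (b₁ b₂ : Test)

/-- Programs. -/
inductive Cmd where
  | skip
  | set (x : ℕ) (e : Expr)
  | put (a : ℕ) (i e : Expr)
  | seq (p q : Cmd)
  | cond (b : Test) (p q : Cmd)
  | loop (b : Test) (p : Cmd)

/-- The contents of the registers, of the arrays and of the read-only table. -/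
structure Memory where
  reg : ℕ → ℕ
  arr : ℕ → ℕ → ℕ
  table : ℕ → ℝ

namespace Expr

/-- The value of an expression. -/
def eval : Expr → Memory → ℕ
  | lit k, _ => k
  | reg x, m => m.reg x
  | get a i, m => m.arr a (i.eval m)
  | add e₁ e₂, m => e₁.eval m + e₂.eval m
  | sub e₁ e₂, m => e₁.eval m - e₂.eval m

/-- The number of steps that the evaluation takes. -/
def time : Expr → ℕ
  | lit _ => 1
  | reg _ => 1
  | get _ i => i.time + 1
  | add e₁ e₂ => e₁.time + e₂.time + 1
  | sub e₁ e₂ => e₁.time + e₂.time + 1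

end Expr

namespace Test

/-- The truth of a test. -/
def Holds : Test → Memory → Prop
  | le e₁ e₂, m => e₁.eval m ≤ e₂.eval m
  | tableLe i j, m => m.table (i.eval m) ≤ m.table (j.eval m)
  | neg b, m => ¬ b.Holds m
  | both b₁ b₂, m => b₁.Holds m ∧ b₂.Holds m

/-- The number of steps that the evaluation takes. -/
def time : Test → ℕ
  | le e₁ e₂ => e₁.time + e₂.time + 1
  | tableLe i j => i.time + j.time + 1
  | neg b => b.time + 1
  | both b₁ b₂ => b₁.time + b₂.time + 1

end Test

namespace Memory

/-- Write `v` into register `x`. -/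
def setReg (m : Memory) (x v : ℕ) : Memory :=
  { m with reg := Function.update m.reg x v }

/-- Write `v` into entry `i` of array `a`. -/
def setArr (m : Memory) (a i v : ℕ) : Memory :=
  { m with arr := Function.update m.arr a (Function.update (m.arr a) i v) }

end Memory

/-- `Exec p m t m'`: started in `m`, the program `p` halts after exactly `t` steps in `m'`. -/
inductive Exec : Cmd → Memory → ℕ → Memory → Prop where
  | skip (m : Memory) : Exec Cmd.skip m 1 m
  | set (x : ℕ) (e : Expr) (m : Memory) :
      Exec (Cmd.set x e) m (e.time + 1) (m.setReg x (e.eval m))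
  | put (a : ℕ) (i e : Expr) (m : Memory) :
      Exec (Cmd.put a i e) m (i.time + e.time + 1) (m.setArr a (i.eval m) (e.eval m))
  | seq {p q : Cmd} {m₀ m₁ m₂ : Memory} {t₁ t₂ : ℕ} :
      Exec p m₀ t₁ m₁ → Exec q m₁ t₂ m₂ → Exec (Cmd.seq p q) m₀ (t₁ + t₂) m₂
  | cond_true {b : Test} {p q : Cmd} {m m' : Memory} {t : ℕ} :
      b.Holds m → Exec p m t m' → Exec (Cmd.cond b p q) m (b.time + t + 1) m'
  | cond_false {b : Test} {p q : Cmd} {m m' : Memory} {t : ℕ} :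
      ¬ b.Holds m → Exec q m t m' → Exec (Cmd.cond b p q) m (b.time + t + 1) m'
  | loop_false {b : Test} {p : Cmd} {m : Memory} :
      ¬ b.Holds m → Exec (Cmd.loop b p) m (b.time + 1) m
  | loop_true {b : Test} {p : Cmd} {m₀ m₁ m₂ : Memory} {t₁ t₂ : ℕ} :
      b.Holds m₀ → Exec p m₀ t₁ m₁ → Exec (Cmd.loop b p) m₁ t₂ m₂ →
      Exec (Cmd.loop b p) m₀ (b.time + t₁ + t₂ + 1) m₂

/-! ## Input and output of the machine -/

/-- The initial memory for an input with vertices `0, …, n - 1`: register `0` holds `n`, array `0`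
is the indicator of `I`, entry `u * n + v` of the table is the cost of `(u, v)`; everything else
is `0`. -/
noncomputable def load {n : ℕ} (P : Input (Fin n)) : Memory where
  reg x := if x = 0 then n else 0
  arr a i := if a = 0 ∧ ∃ v ∈ P.I, (v : ℕ) = i then 1 else 0
  table j := ∑ e : Fin n × Fin n, if (e.1 : ℕ) * n + e.2 = j then P.cost e else 0

/-- Array `a` holds the adjacency matrix of the graph with edge set `E`. -/
def HoldsEdges {n : ℕ} (m : Memory) (a : ℕ) (E : Finset (Fin n × Fin n)) : Prop :=
  ∀ u v : Fin n, m.arr a (u * n + v) = if (u, v) ∈ E then 1 else 0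

/-- Array `a`, from entry `off` on, holds the matching `M`: entry `off + v`, for a target vertex
`v`, is `i + 1` if the component of `v` is matched to `i`, and `0` if it is not matched. -/
def HoldsMatching {n : ℕ} (P : Input (Fin n)) (m : Memory) (a off : ℕ)
    (M : Finset (Finset (Fin n) × Fin n)) : Prop :=
  ∀ v ∈ P.targets,
    (∃ x ∈ M, v ∈ x.1 ∧ m.arr a (off + v) = (x.2 : ℕ) + 1) ∨
    ((∀ x ∈ M, v ∉ x.1) ∧ m.arr a (off + v) = 0)

/-- The memory `m` documents the run `σ 0, …, σ T` and holds what it returns: register `1` is `T`;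
entries `k` of the arrays `1` and `2` are the two ends of the edge deleted in iteration `k`;
array `3`, from entry `k * n` on, is the matching after `k` iterations; array `4` is `H*` and
array `5` is `M*`. -/
def Documents {n : ℕ} (P : Input (Fin n)) (m : Memory) (T : ℕ)
    (σ : ℕ → AlgState (Fin n)) : Prop :=
  m.reg 1 = T ∧
  (∀ k < T, ∃ u v : Fin n, m.arr 1 k = u ∧ m.arr 2 k = v ∧ P.Body (u, v) (σ k) (σ (k + 1))) ∧
  (∀ k ≤ T, HoldsMatching P m 3 (k * n) (σ k).M) ∧
  ∃ E M, (σ T).best = some (E, M) ∧ HoldsEdges m 4 E ∧ HoldsMatching P m 5 0 M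

end SCCMatching

/-! Correctness rests on monotonicity (`Feasible.mono`): if a subgraph admits a matching of all its
components, so does every larger subgraph of `G`. Adding edges only merges components, so each new
component contains an old one and can inherit its partner, and distinct new components contain
distinct old ones. Since edges are deleted in order of decreasing cost, every deleted edge costs at
least as much as every remaining one. When the loop condition fails, the current graph contains no
feasible subgraph. So each feasible subgraph uses a deleted edge, whose cost is at least that of the
last deleted one, and this is the maximum cost of the returned graph (`IsRun.exists_solution`).

For the running time, `targets_card_mul_le` gives `|V'| * n ≤ |E|`. There are at most `|E|`
iterations, so each may take time `O((|V'| * n) ^ 2)`. The components come from Warshall's algorithm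
restricted to inner vertices in `V'`, in time `O(|V'| * n ^ 2)`. The maximum matching comes from an
auction: a component without partner takes a neighbour of least level, raises that level by one and
thereby evicts the former owner, who bids next; a bidder all of whose neighbours have reached level
`|V'| + 1` gives up. Levels never fall, which bounds the number of bids. At the end some level
between `1` and `|V'| + 1` is unused, and cutting there yields a vertex cover as large as the
matching (`isMaximumMatching_of_levels`).

The machine part is a small program logic: `Runs` is a total correctness statement with a time
bound, and `Cmd.Frame` records what a program cannot have changed. The subroutines are verified
separately and combined in `runs_compute`, `runs_iteration` and `runs_algorithm`. -/

namespace SCCMatching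

/-! ## Components as classes of mutual reachability -/

section Components

variable {V : Type*} {E E' : Finset (V × V)} {W : Finset V}

/-- `v` is reachable from `u` in the subgraph induced on `W`. -/
def Reach (E : Finset (V × V)) (W : Finset V) : V → V → Prop :=
  Relation.ReflTransGen fun a b => (a, b) ∈ E ∧ a ∈ W ∧ b ∈ W

theorem Reach.trans {u v w : V} (h : Reach E W u v) (h' : Reach E W v w) : Reach E W u w :=
  Relation.ReflTransGen.trans h h'

theorem Reach.mono {W' : Finset V} (hE : E' ⊆ E) (hW : W' ⊆ W) {u v : V} (h : Reach E' W' u v) :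
    Reach E W u v :=
  Relation.ReflTransGen.mono (fun _ _ h => ⟨hE h.1, hW h.2.1, hW h.2.2⟩) _ _ h

open Classical in
/-- The vertices of `W` that lie on a closed walk through `q` in the subgraph induced on `W`. -/
noncomputable def component (E : Finset (V × V)) (W : Finset V) (q : V) : Finset V :=
  W.filter fun u => Reach E W q u ∧ Reach E W u q

theorem mem_component {q u : V} :
    u ∈ component E W q ↔ u ∈ W ∧ Reach E W q u ∧ Reach E W u q := by
  simp [component]

theorem self_mem_component {q : V} (hq : q ∈ W) : q ∈ component E W q :=
  mem_component.2 ⟨hq, .refl, .refl⟩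

theorem component_eq {q u : V} (h : u ∈ component E W q) : component E W u = component E W q := by
  obtain ⟨_, h1, h2⟩ := mem_component.1 h
  ext w
  simp only [mem_component]
  exact ⟨fun ⟨a, b, c⟩ => ⟨a, h1.trans b, c.trans h2⟩, fun ⟨a, b, c⟩ => ⟨a, h2.trans b, c.trans h1⟩⟩

theorem component_eq_iff {q u : V} (hu : u ∈ W) :
    component E W u = component E W q ↔ Reach E W q u ∧ Reach E W u q := by
  constructor
  · intro h
    have := self_mem_component (E := E) hu
    rw [h, mem_component] at this
    exact this.2
  · exact fun h => component_eq (mem_component.2 ⟨hu, h⟩)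

theorem component_mono (h : E' ⊆ E) (q : V) : component E' W q ⊆ component E W q := by
  intro u hu
  rw [mem_component] at hu ⊢
  exact ⟨hu.1, hu.2.1.mono h subset_rfl, hu.2.2.mono h subset_rfl⟩

/-- A path from `u` to `v` in `W` never leaves the component: each vertex on it is reachable from
`q` through `u` and reaches `q` through `v`. -/
theorem stronglyConnected_component (q : V) : StronglyConnected E (component E W q) := by
  intro u hu v hv
  obtain ⟨_, h1, h2⟩ := mem_component.1 hu
  obtain ⟨_, h3, h4⟩ := mem_component.1 hv
  have huv : Reach E W u v := h2.trans h3
  clear h3 hv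
  induction huv using Relation.ReflTransGen.head_induction_on with
  | refl => exact .refl
  | @head a b hab hbv ih =>
    have hb : b ∈ component E W q := mem_component.2
      ⟨hab.2.2, h1.trans (.single hab), Reach.trans hbv h4⟩
    exact .head ⟨hab.1, hu, hb⟩ (ih hb (mem_component.1 hb).1 (mem_component.1 hb).2.1 (mem_component.1 hb).2.2)

/-- A strongly connected subset of `W` that contains `q` lies in the class of `q`, and this class is
itself strongly connected. So the maximal sets are exactly the classes of mutual reachability, the
form in which components are computed. -/
theorem mem_sccs {Q : Finset V} : Q ∈ sccs E W ↔ ∃ q ∈ W, Q = component E W q := by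
  have key : ∀ R : Finset V, R ⊆ W → StronglyConnected E R → ∀ q ∈ R, R ⊆ component E W q := by
    intro R hRW hR q hq u hu
    exact mem_component.2 ⟨hRW hu,
      Relation.ReflTransGen.mono (fun _ _ h => ⟨h.1, hRW h.2.1, hRW h.2.2⟩) _ _ (hR q hq u hu),
      Relation.ReflTransGen.mono (fun _ _ h => ⟨h.1, hRW h.2.1, hRW h.2.2⟩) _ _ (hR u hu q hq)⟩
  have sub : ∀ q, component E W q ⊆ W := fun q u hu => (mem_component.1 hu).1
  simp only [sccs, Finset.mem_filter, Finset.mem_powerset]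
  constructor
  · rintro ⟨hQW, ⟨⟨⟨q, hq⟩, -, hQ⟩, hmax⟩⟩
    refine ⟨q, hQW hq, (key Q hQW hQ q hq).antisymm ?_⟩
    exact hmax ⟨⟨q, self_mem_component (hQW hq)⟩, sub q, stronglyConnected_component q⟩
      (key Q hQW hQ q hq)
  · rintro ⟨q, hq, rfl⟩
    refine ⟨sub q, ⟨⟨q, self_mem_component hq⟩, sub q, stronglyConnected_component q⟩, ?_⟩
    rintro R ⟨-, hRW, hR⟩ hle
    exact key R hRW hR q (hle (self_mem_component hq))

end Components

/-! ## Matchings -/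

section Matchings

variable {A B : Type*} {F M : Finset (A × B)}

theorem isMatching_empty : IsMatching F ∅ := ⟨by simp, by simp⟩

theorem exists_isMaximumMatching (F : Finset (A × B)) : ∃ M, IsMaximumMatching F M := by
  classical
  obtain ⟨M, hM, hmax⟩ := (F.powerset.filter (IsMatching F)).exists_max_image Finset.card
    ⟨∅, by simp [isMatching_empty]⟩
  refine ⟨M, (Finset.mem_filter.1 hM).2, fun M' h' => hmax M' ?_⟩
  simp [h', h'.1]

theorem IsMatching.injOn_fst (h : IsMatching F M) : Set.InjOn Prod.fst (M : Set (A × B)) := by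
  intro x hx y hy hxy
  by_contra hne
  exact (h.2 x hx y hy hne).1 hxy

theorem IsMatching.injOn_snd (h : IsMatching F M) : Set.InjOn Prod.snd (M : Set (A × B)) := by
  intro x hx y hy hxy
  by_contra hne
  exact (h.2 x hx y hy hne).2 hxy

/-- A matching is no larger than a vertex cover. -/
theorem IsMatching.card_le_of_cover (h : IsMatching F M) (X : Finset A) (Y : Finset B)
    (hXY : ∀ x ∈ F, x.1 ∈ X ∨ x.2 ∈ Y) : M.card ≤ X.card + Y.card := by
  classical
  have h1 : (M.filter fun x => x.1 ∈ X).card ≤ X.card :=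
    Finset.card_le_card_of_injOn Prod.fst (fun x hx => (Finset.mem_filter.1 hx).2)
      (h.injOn_fst.mono fun _ hx => (Finset.mem_filter.1 hx).1)
  have h2 : (M.filter fun x => ¬ x.1 ∈ X).card ≤ Y.card :=
    Finset.card_le_card_of_injOn Prod.snd
      (fun x hx => (hXY x (h.1 (Finset.mem_filter.1 hx).1)).resolve_left (Finset.mem_filter.1 hx).2)
      (h.injOn_snd.mono fun _ hx => (Finset.mem_filter.1 hx).1)
  have := Finset.card_filter_add_card_filter_not (s := M) (fun x => x.1 ∈ X)
  omega

/-- A matching as large as one side matches all of that side. -/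
theorem IsMatching.exists_mem_of_card (h : IsMatching F M) {X : Finset A}
    (hF : ∀ x ∈ F, x.1 ∈ X) (hcard : M.card = X.card) {a : A} (ha : a ∈ X) :
    ∃ b, (a, b) ∈ M := by
  classical
  have himg : M.image Prod.fst = X := by
    refine Finset.eq_of_subset_of_card_le ?_ ?_
    · intro a ha
      obtain ⟨x, hx, rfl⟩ := Finset.mem_image.1 ha
      exact hF x (h.1 hx)
    · rw [Finset.card_image_of_injOn h.injOn_fst, hcard]
  rw [← himg] at ha
  obtain ⟨x, hx, rfl⟩ := Finset.mem_image.1 ha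
  exact ⟨x.2, hx⟩

/-- If the owners `own b` and the levels `d b` of the vertices on one side are such that every
owner has (up to one) a lowest vertex, and vertices that own nothing see only high levels, then
the owners form a maximum matching. -/
theorem isMaximumMatching_of_levels (X : Finset A) (hF : ∀ x ∈ F, x.1 ∈ X)
    (hM : IsMatching F M) (d : B → ℕ) {l : ℕ} (hl : X.card < l)
    (hfree : ∀ b, (∀ a, (a, b) ∉ M) → d b = 0)
    (hlow : ∀ a b b', (a, b) ∈ M → (a, b') ∈ F → d b ≤ d b' + 1)
    (hhigh : ∀ a ∈ X, (∀ b, (a, b) ∉ M) → ∀ b, (a, b) ∈ F → l ≤ d b) :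
    IsMaximumMatching F M := by
  classical
  have hMX : M.card ≤ X.card :=
    Finset.card_le_card_of_injOn Prod.fst (fun x hx => hF x (hM.1 hx)) hM.injOn_fst
  -- Pigeonhole: the `l` levels `1, …, l` outnumber the edges of `M`, so some level `g` belongs to
  -- no matched vertex. Unmatched vertices have level `0`, so no vertex at all has level `g`.
  obtain ⟨g, hg, hgap⟩ : ∃ g ∈ Finset.Icc 1 l, g ∉ M.image fun x => d x.2 := by
    by_contra! hcon
    have := Finset.card_le_card (show Finset.Icc 1 l ⊆ M.image fun x => d x.2 from hcon)
    have h2 := Finset.card_image_le (s := M) (f := fun x => d x.2)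
    rw [Nat.card_Icc] at this
    omega
  rw [Finset.mem_Icc] at hg
  have hgap' : ∀ b, d b ≠ g := by
    intro b hb
    by_cases hex : ∃ a, (a, b) ∈ M
    · obtain ⟨a, ha⟩ := hex
      exact hgap (Finset.mem_image.2 ⟨_, ha, hb⟩)
    · push Not at hex
      have := hfree b hex
      omega
  refine ⟨hM, fun M' hM' => ?_⟩
  -- The cover takes the right end of each edge of `M` above the gap and the left end of each edge
  -- below it. If `(a, b)` has `b` below the gap, then `a` is matched by `hhigh`, and to a vertex of
  -- level at most `d b + 1 ≤ g`, hence below the gap as well.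
  refine (hM'.card_le_of_cover ((M.filter fun x => ¬ g < d x.2).image Prod.fst)
    ((M.filter fun x => g < d x.2).image Prod.snd) ?_).trans ?_
  · rintro ⟨a, b⟩ hab
    by_cases hb : g < d b
    · right
      obtain ⟨a', ha'⟩ : ∃ a', (a', b) ∈ M := by
        by_contra! hcon
        have := hfree b hcon
        omega
      exact Finset.mem_image.2 ⟨(a', b), by simp [ha', hb], rfl⟩
    · left
      obtain ⟨b', hb'⟩ : ∃ b', (a, b') ∈ M := by
        by_contra! hcon
        have := hhigh a (hF _ hab) hcon b hab
        have := hgap' b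
        omega
      refine Finset.mem_image.2 ⟨(a, b'), ?_, rfl⟩
      have := hlow a b' b hb' hab
      have := hgap' b
      have := hgap' b'
      simp only [Finset.mem_filter, hb', true_and]
      omega
  · have h1 := Finset.card_image_le (s := M.filter fun x => ¬ g < d x.2) (f := Prod.fst)
    have h2 := Finset.card_image_le (s := M.filter fun x => g < d x.2) (f := Prod.snd)
    have := Finset.card_filter_add_card_filter_not (s := M) (fun x => g < d x.2)
    omega

end Matchings

/-! ## Correctness of the algorithm -/

namespace Input

section Correctness

variable {V : Type*} [Fintype V] {E E' : Finset (V × V)}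

variable [DecidableEq V] (P : Input V)

theorem fst_mem_sccs {x : Finset V × V} (hx : x ∈ P.bip E) : x.1 ∈ sccs E P.targets := by
  simp only [bip, Finset.mem_filter, Finset.mem_product] at hx
  exact hx.1.1

theorem targets_nonempty : P.targets.Nonempty := by
  by_contra h
  rw [Finset.not_nonempty_iff_eq_empty, targets, Finset.sdiff_eq_empty_iff_subset] at h
  exact P.proper (Finset.eq_univ_iff_forall.2 fun v => h (Finset.mem_univ v))

theorem sccs_nonempty : (sccs E P.targets).Nonempty :=
  let ⟨v, hv⟩ := P.targets_nonempty
  ⟨_, mem_sccs.2 ⟨v, hv, rfl⟩⟩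

variable {P}

theorem card_matching_le {M : Finset (Finset V × V)} (h : IsMatching (P.bip E) M) :
    M.card ≤ (sccs E P.targets).card :=
  Finset.card_le_card_of_injOn Prod.fst (fun _ hx => P.fst_mem_sccs (h.1 hx)) h.injOn_fst

/-- Each component `Q` of the larger graph contains a component of the smaller one, and takes over
its partner. If two components get the same partner, they contain the same small component, so they
meet and are equal. -/
theorem Feasible.mono {M' : Finset (Finset V × V)} (h : P.Feasible E' M') (hE : E' ⊆ E)
    (hEP : E ⊆ P.edges) : ∃ M, P.Feasible E M := by
  classical
  have hex : ∀ Q ∈ sccs E P.targets, ∃ x ∈ M', x.1 ⊆ Q ∧ (Q, x.2) ∈ P.bip E := by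
    intro Q hQ
    obtain ⟨q, hq, rfl⟩ := mem_sccs.1 hQ
    obtain ⟨i, hi⟩ := h.2.1.exists_mem_of_card (fun _ => P.fst_mem_sccs) h.2.2
      (mem_sccs.2 ⟨q, hq, rfl⟩)
    refine ⟨_, hi, component_mono hE q, ?_⟩
    have := h.2.1.1 hi
    simp only [bip, Finset.mem_filter, Finset.mem_product] at this ⊢
    obtain ⟨⟨-, hiI⟩, q₁, h1, q₂, h2, h3, h4⟩ := this
    exact ⟨⟨hQ, hiI⟩, q₁, component_mono hE q h1, q₂, component_mono hE q h2, hE h3, hE h4⟩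
  have : Nonempty V := ⟨P.nonempty.choose⟩
  choose! f hf hsub hbip using hex
  have hinj : ∀ Q ∈ sccs E P.targets, ∀ R ∈ sccs E P.targets, (f Q).2 = (f R).2 → Q = R := by
    intro Q hQ R hR hQR
    have heq := h.2.1.injOn_snd (hf Q hQ) (hf R hR) hQR
    obtain ⟨p, -, hp⟩ := mem_sccs.1 (P.fst_mem_sccs (h.2.1.1 (hf Q hQ)))
    obtain ⟨v, hv⟩ : (f Q).1.Nonempty := by
      obtain ⟨q, hq, hq'⟩ := mem_sccs.1 (P.fst_mem_sccs (h.2.1.1 (hf Q hQ)))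
      exact ⟨q, hq' ▸ self_mem_component hq⟩
    have hvQ := hsub Q hQ hv
    have hvR := hsub R hR (heq ▸ hv)
    obtain ⟨q, -, rfl⟩ := mem_sccs.1 hQ
    obtain ⟨r, -, rfl⟩ := mem_sccs.1 hR
    rw [← component_eq hvQ, component_eq hvR]
  refine ⟨(sccs E P.targets).image fun Q => (Q, (f Q).2), hEP, ⟨?_, ?_⟩, ?_⟩
  · intro x hx
    obtain ⟨Q, hQ, rfl⟩ := Finset.mem_image.1 hx
    exact hbip Q hQ
  · intro x hx y hy hxy
    obtain ⟨Q, hQ, rfl⟩ := Finset.mem_image.1 hx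
    obtain ⟨R, hR, rfl⟩ := Finset.mem_image.1 hy
    have : Q ≠ R := by
      rintro rfl
      exact hxy rfl
    exact ⟨this, fun hc => this (hinj Q hQ R hR hc)⟩
  · exact Finset.card_image_of_injective _ fun Q R hQR => (Prod.ext_iff.1 hQR).1

/-- One maximum matching decides feasibility, so the loop condition does not depend on which maximum
matching was chosen. -/
theorem Feasible.guard {M M' : Finset (Finset V × V)} (h : P.Feasible E M')
    (hM : IsMaximumMatching (P.bip E) M) : M.card = (sccs E P.targets).card :=
  (card_matching_le hM.1).antisymm (h.2.2 ▸ hM.2 M' h.2.1)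

variable (P) in
-- In the input graph all edges inside `V'` are present, so `V'` is a single component, adjacent to
-- every `i ∈ I`. Hence the loop body is executed at least once and the result is defined.
theorem exists_feasible_edges : ∃ M, P.Feasible P.edges M := by
  obtain ⟨v, hv⟩ := P.targets_nonempty
  obtain ⟨i, hi⟩ := P.nonempty
  have hvI : v ∉ P.I := by simpa [targets] using hv
  have hsccs : sccs P.edges P.targets = {component P.edges P.targets v} := by
    ext Q
    rw [mem_sccs, Finset.mem_singleton]
    constructor
    · rintro ⟨q, hq, rfl⟩
      have hqI : q ∉ P.I := by simpa [targets] using hq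
      refine (component_eq_iff hq).2 ⟨.single ⟨?_, hv, hq⟩, .single ⟨?_, hq, hv⟩⟩ <;>
        simp [edges, hvI]
    · rintro rfl
      exact ⟨v, hv, rfl⟩
  refine ⟨{(component P.edges P.targets v, i)}, subset_rfl, ⟨?_, ?_⟩, by simp [hsccs]⟩
  · rw [Finset.singleton_subset_iff]
    simp only [bip, Finset.mem_filter, Finset.mem_product, hsccs, Finset.mem_singleton, hi, and_true,
      true_and]
    exact ⟨v, self_mem_component hv, v, self_mem_component hv, by simp [edges, hvI],
      by simp [edges, hvI]⟩
  · simp only [Finset.mem_singleton]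
    rintro x rfl y rfl hxy
    exact absurd rfl hxy

/-- Without edges only the empty matching exists, but `V'` has at least one component. So whenever
the loop condition holds there is an edge to delete. -/
theorem not_guard_of_G_eq_empty {s : AlgState V} (hs : IsMatching (P.bip s.G) s.M)
    (h : s.G = ∅) : ¬ P.Guard s := by
  intro hg
  have : s.M = ∅ := by
    rw [Finset.eq_empty_iff_forall_notMem]
    intro x hx
    have := hs.1 hx
    simp [bip, h] at this
  rw [Guard, this, Finset.card_empty] at hg
  exact P.sccs_nonempty.card_pos.ne hg

theorem IsRun.of_succ {T : ℕ} {σ : ℕ → AlgState V} (h : P.IsRun (T + 1) σ) : P.IsRun T σ :=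
  ⟨h.1, fun k hk => h.2 k (by omega)⟩

/-- What holds in front of every iteration. -/
theorem IsRun.invariant {T : ℕ} {σ : ℕ → AlgState V} (h : P.IsRun T σ) :
    (σ T).G ⊆ P.edges ∧ (σ T).G.card + T = P.edges.card ∧
    IsMaximumMatching (P.bip (σ T).G) (σ T).M ∧
    ∀ e ∈ P.edges, e ∉ (σ T).G → ∀ f ∈ (σ T).G, P.cost f ≤ P.cost e := by
  induction T with
  | zero =>
    obtain ⟨⟨h1, h2, -⟩, -⟩ := h
    refine ⟨h1.subset, by simp [h1], h2, fun e he he' => ?_⟩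
    rw [h1] at he'
    exact absurd he he'
  | succ T ih =>
    obtain ⟨i1, i2, -, i4⟩ := ih h.of_succ
    obtain ⟨-, e, he, hmax, hG, -, hM⟩ := h.2 T (by omega)
    refine ⟨?_, ?_, hM, ?_⟩
    · rw [hG]
      exact (Finset.erase_subset _ _).trans i1
    · rw [hG, Finset.card_erase_of_mem he]
      have := Finset.card_pos.2 ⟨e, he⟩
      omega
    · intro a ha ha' f hf
      rw [hG] at ha' hf
      have hf' := Finset.mem_of_mem_erase hf
      by_cases hae : a = e
      · exact hae ▸ hmax f hf'
      · exact i4 a ha (fun hc => ha' (Finset.mem_erase.2 ⟨hae, hc⟩)) f hf'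

theorem IsRun.le_card {T : ℕ} {σ : ℕ → AlgState V} (h : P.IsRun T σ) : T ≤ P.edges.card := by
  have := h.invariant.2.1
  omega

theorem IsRun.nonempty {T : ℕ} {σ : ℕ → AlgState V} (h : P.IsRun T σ) (hg : P.Guard (σ T)) :
    (σ T).G.Nonempty := by
  by_contra hne
  exact not_guard_of_G_eq_empty h.invariant.2.2.1.1 (Finset.not_nonempty_iff_eq_empty.1 hne) hg

variable (P) in
theorem exists_isStart : ∃ s, P.IsStart s :=
  let ⟨M, hM⟩ := exists_isMaximumMatching (P.bip P.edges)
  ⟨⟨P.edges, M, none⟩, rfl, hM, rfl⟩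

theorem IsRun.exists_step {T : ℕ} {σ : ℕ → AlgState V} (h : P.IsRun T σ) (hg : P.Guard (σ T)) :
    ∃ s', P.Step (σ T) s' := by
  obtain ⟨e, he, hmax⟩ := (σ T).G.exists_max_image P.cost (h.nonempty hg)
  obtain ⟨M, hM⟩ := exists_isMaximumMatching (P.bip ((σ T).G.erase e))
  exact ⟨⟨(σ T).G.erase e, M, some ((σ T).G, (σ T).M)⟩, hg, e, he, hmax, rfl, rfl, hM⟩

theorem IsRun.exists_solution {T : ℕ} {σ : ℕ → AlgState V} (h : P.IsRun T σ)
    (hg : ¬ P.Guard (σ T)) : ∃ E M, (σ T).best = some (E, M) ∧ P.IsSolution E M := by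
  cases T with
  | zero =>
    obtain ⟨⟨h1, h2, -⟩, -⟩ := h
    obtain ⟨M, hM⟩ := P.exists_feasible_edges
    rw [← h1] at hM
    exact absurd (hM.guard h2) hg
  | succ T =>
    obtain ⟨hgT, e, he, hmax, hG, hbest, -⟩ := h.2 T (by omega)
    obtain ⟨i1, -, i3, i4⟩ := h.of_succ.invariant
    refine ⟨_, _, hbest, ⟨i1, i3.1, hgT⟩, fun E' M' hF => ?_⟩
    -- A feasible graph inside the final one would, by monotonicity, make the final one feasible,
    -- and the loop would have gone on.
    have hne : ¬ E' ⊆ (σ (T + 1)).G := by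
      intro hsub
      obtain ⟨M, hM⟩ := hF.mono hsub h.invariant.1
      exact hg (hM.guard h.invariant.2.2.1)
    obtain ⟨f, hf, hf'⟩ := Finset.not_subset.1 hne
    have hle : P.cost e ≤ P.cost f := by
      rw [hG] at hf'
      by_cases hfG : f ∈ (σ T).G
      · have : f = e := by
          by_contra hc
          exact hf' (Finset.mem_erase.2 ⟨hc, hfG⟩)
        rw [this]
      · exact i4 f (hF.1 hf) hfG e he
    refine (Finset.max_le fun c hc => ?_ : P.cmax (σ T).G ≤ ((P.cost e : ℝ) : WithBot ℝ)).trans ?_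
    · obtain ⟨a, ha, rfl⟩ := Finset.mem_image.1 hc
      exact WithBot.coe_le_coe.2 (hmax a ha)
    · exact (WithBot.coe_le_coe.2 hle).trans (Finset.le_max (Finset.mem_image_of_mem _ hf))

end Correctness

end Input

/-! ## Reasoning about programs -/

namespace Memory

variable (m : Memory) (x y v a b i : ℕ)

@[simp] theorem setReg_reg : (m.setReg x v).reg y = if y = x then v else m.reg y := by
  simp [setReg, Function.update_apply]

@[simp] theorem setReg_arr : (m.setReg x v).arr = m.arr := rfl

@[simp] theorem setReg_table : (m.setReg x v).table = m.table := rfl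

@[simp] theorem setArr_reg : (m.setArr a i v).reg = m.reg := rfl

@[simp] theorem setArr_table : (m.setArr a i v).table = m.table := rfl

theorem setArr_arr : (m.setArr a i v).arr b =
    if b = a then Function.update (m.arr a) i v else m.arr b := by
  simp only [setArr, Function.update_apply]

@[simp] theorem setArr_apply (j : ℕ) : (m.setArr a i v).arr b j =
    if b = a ∧ j = i then v else m.arr b j := by
  rw [setArr_arr]
  split_ifs with h1 h2 h2 <;> simp_all

end Memory

/-! ### What a program may write. -/

namespace Cmd

/-- Whether a command occurs in `p` that writes into register `x`. -/
def writesReg : Cmd → ℕ → Bool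
  | skip, _ => false
  | set y _, x => x == y
  | put _ _ _, _ => false
  | seq p q, x => p.writesReg x || q.writesReg x
  | cond _ p q, x => p.writesReg x || q.writesReg x
  | loop _ p, x => p.writesReg x

/-- Whether a command occurs in `p` that writes into array `a`. -/
def writesArr : Cmd → ℕ → Bool
  | skip, _ => false
  | set _ _, _ => false
  | put b _ _, a => a == b
  | seq p q, a => p.writesArr a || q.writesArr a
  | cond _ p q, a => p.writesArr a || q.writesArr a
  | loop _ p, a => p.writesArr a

/-- `m` and `m'` differ at most in what `p` may write. -/
structure Frame (p : Cmd) (m m' : Memory) : Prop where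
  reg : ∀ x, p.writesReg x = false → m'.reg x = m.reg x
  arr : ∀ a, p.writesArr a = false → m'.arr a = m.arr a
  table : m'.table = m.table

variable {p q : Cmd} {m m' m'' : Memory}

theorem Frame.refl : p.Frame m m := ⟨fun _ _ => rfl, fun _ _ => rfl, rfl⟩

theorem Frame.trans (h : p.Frame m m') (h' : p.Frame m' m'') : p.Frame m m'' :=
  ⟨fun x hx => (h'.reg x hx).trans (h.reg x hx), fun a ha => (h'.arr a ha).trans (h.arr a ha),
    h'.table.trans h.table⟩

theorem Frame.of_le (h : p.Frame m m') (hr : ∀ x, q.writesReg x = false → p.writesReg x = false)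
    (ha : ∀ a, q.writesArr a = false → p.writesArr a = false) : q.Frame m m' :=
  ⟨fun x hx => h.reg x (hr x hx), fun a h' => h.arr a (ha a h'), h.table⟩

end Cmd

/-- The footprint is a Boolean function of the program text, so preservation of a register or an
array is later settled by `rfl`. -/
theorem Exec.frame {p : Cmd} {m m' : Memory} {t : ℕ} (h : Exec p m t m') : p.Frame m m' := by
  induction h with
  | skip m => exact .refl
  | set x e m =>
    refine ⟨fun y hy => ?_, fun _ _ => rfl, rfl⟩
    have : y ≠ x := by simpa [Cmd.writesReg] using hy
    simp [this]
  | put a i e m =>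
    refine ⟨fun _ _ => rfl, fun b hb => ?_, rfl⟩
    have : b ≠ a := by simpa [Cmd.writesArr] using hb
    simp [Memory.setArr_arr, this]
  | seq _ _ h1 h2 =>
    exact (h1.of_le (by simp +contextual [Cmd.writesReg]) (by simp +contextual [Cmd.writesArr])).trans
      (h2.of_le (by simp +contextual [Cmd.writesReg]) (by simp +contextual [Cmd.writesArr]))
  | cond_true _ _ h1 =>
    exact h1.of_le (by simp +contextual [Cmd.writesReg]) (by simp +contextual [Cmd.writesArr])
  | cond_false _ _ h1 =>
    exact h1.of_le (by simp +contextual [Cmd.writesReg]) (by simp +contextual [Cmd.writesArr])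
  | loop_false _ => exact .refl
  | loop_true _ _ _ h1 h2 =>
    exact (h1.of_le (by simp [Cmd.writesReg]) (by simp [Cmd.writesArr])).trans h2

/-! ### Total correctness with time bounds. -/

/-- Started in `m`, the program `p` halts after at most `B` steps in a memory with property `Q`. -/
def Runs (p : Cmd) (m : Memory) (B : ℕ) (Q : Memory → Prop) : Prop :=
  ∃ t m', Exec p m t m' ∧ t ≤ B ∧ Q m'

namespace Runs

variable {p q : Cmd} {b : Test} {m : Memory} {B B' : ℕ} {Q Q' : Memory → Prop}

theorem mono (h : Runs p m B Q) (hB : B ≤ B') (hQ : ∀ m', Q m' → Q' m') : Runs p m B' Q' :=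
  let ⟨t, m', h1, h2, h3⟩ := h
  ⟨t, m', h1, h2.trans hB, hQ m' h3⟩

theorem le (h : Runs p m B Q) (hB : B ≤ B') : Runs p m B' Q := h.mono hB fun _ => id

/-- A program leaves alone what it does not write. -/
theorem frame (h : Runs p m B Q) : Runs p m B fun m' => p.Frame m m' ∧ Q m' :=
  let ⟨t, m', h1, h2, h3⟩ := h
  ⟨t, m', h1, h2, h1.frame, h3⟩

/-- The second program may use the frame of the first, so postconditions need only mention what was
changed. -/
theorem seq (h : Runs p m B fun m' => p.Frame m m' → Runs q m' B' Q) :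
    Runs (.seq p q) m (B + B') Q := by
  obtain ⟨t, m', h1, h2, h3⟩ := h
  obtain ⟨t', m'', h1', h2', h3'⟩ := h3 h1.frame
  exact ⟨_, _, .seq h1 h1', by omega, h3'⟩

theorem cond (h1 : b.Holds m → Runs p m B Q) (h2 : ¬ b.Holds m → Runs q m B Q) :
    Runs (.cond b p q) m (b.time + B + 1) Q := by
  by_cases hb : b.Holds m
  · obtain ⟨t, m', h, ht, hQ⟩ := h1 hb
    exact ⟨_, _, .cond_true hb h, by omega, hQ⟩
  · obtain ⟨t, m', h, ht, hQ⟩ := h2 hb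
    exact ⟨_, _, .cond_false hb h, by omega, hQ⟩

theorem set {x : ℕ} {e : Expr} (h : Q (m.setReg x (e.eval m))) :
    Runs (.set x e) m (e.time + 1) Q :=
  ⟨_, _, .set x e m, le_rfl, h⟩

/-- Loops whose number of iterations is bounded by a decreasing variant. -/
theorem loop (Inv : ℕ → Memory → Prop)
    (hstep : ∀ k m', p.Frame m m' → b.Holds m' → Inv k m' →
      Runs p m' B fun m'' => ∃ j < k, Inv j m'')
    {k : ℕ} (h : Inv k m) :
    Runs (.loop b p) m ((k + 1) * (B + b.time + 1)) fun m' => (∃ j, Inv j m') ∧ ¬ b.Holds m' := by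
  -- The factor `k + 1` allows for `k` rounds and the final failing test.
  have key : ∀ k m', p.Frame m m' → Inv k m' →
      Runs (.loop b p) m' ((k + 1) * (B + b.time + 1))
        fun m' => (∃ j, Inv j m') ∧ ¬ b.Holds m' := by
    intro k
    induction k using Nat.strong_induction_on with
    | _ k ih =>
      intro m' hf hk
      by_cases hb : b.Holds m'
      · obtain ⟨t, m'', h1, h2, j, hj, hInv⟩ := hstep k m' hf hb hk
        obtain ⟨t', m3, h1', h2', h3⟩ := ih j hj m'' (hf.trans h1.frame) hInv
        refine ⟨_, _, .loop_true hb h1 h1', ?_, h3⟩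
        have : (j + 1) * (B + b.time + 1) ≤ k * (B + b.time + 1) := Nat.mul_le_mul_right _ hj
        rw [Nat.succ_mul]
        omega
      · refine ⟨_, _, .loop_false hb, ?_, ⟨k, hk⟩, hb⟩
        rw [Nat.succ_mul]
        omega
  exact key k m .refl h

end Runs

/-! ### Symbolic execution of programs without loops. -/

namespace Cmd

/-- Whether a program has no loops. -/
def straight : Cmd → Bool
  | seq p q => p.straight && q.straight
  | cond _ p q => p.straight && q.straight
  | loop _ _ => false
  | _ => true

open Classical in
/-- The effect of a program without loops. -/
noncomputable def run : Cmd → Memory → Memory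
  | skip, m => m
  | set x e, m => m.setReg x (e.eval m)
  | put a i e, m => m.setArr a (i.eval m) (e.eval m)
  | seq p q, m => q.run (p.run m)
  | cond b p q, m => if b.Holds m then p.run m else q.run m
  | loop _ _, m => m

/-- A bound for the number of steps of a program without loops. -/
def cost : Cmd → ℕ
  | skip => 1
  | set _ e => e.time + 1
  | put _ i e => i.time + e.time + 1
  | seq p q => p.cost + q.cost
  | cond b p q => b.time + (p.cost + q.cost) + 1
  | loop _ _ => 0

end Cmd

theorem runs_of_straight {p : Cmd} {m : Memory} {Q : Memory → Prop} (hp : p.straight = true)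
    (h : Q (p.run m)) : Runs p m p.cost Q := by
  induction p generalizing m Q with
  | skip => exact ⟨_, _, .skip m, le_rfl, h⟩
  | set x e => exact ⟨_, _, .set x e m, le_rfl, h⟩
  | put a i e => exact ⟨_, _, .put a i e m, le_rfl, h⟩
  | seq p q ihp ihq =>
    rw [Cmd.straight, Bool.and_eq_true] at hp
    exact Runs.seq (ihp hp.1 fun _ => ihq hp.2 h)
  | cond b p q ihp ihq =>
    rw [Cmd.straight, Bool.and_eq_true] at hp
    refine Runs.cond (fun hb => (ihp hp.1 ?_).le (by simp)) (fun hb => (ihq hp.2 ?_).le (by simp))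
    · simpa [Cmd.run, hb] using h
    · simpa [Cmd.run, hb] using h
  | loop b p => simp [Cmd.straight] at hp

/-- Reduces a loop-free program to a statement about the explicit memory `p.run m`; the numerical
time bound is left to `decide`. -/
theorem Runs.straight {p : Cmd} {m : Memory} {Q : Memory → Prop} {B : ℕ} (hp : p.straight = true)
    (h : Q (p.run m)) (hB : p.cost ≤ B := by decide) : Runs p m B Q :=
  (runs_of_straight hp h).le hB

theorem Runs.branch {p q : Cmd} {b : Test} {m : Memory} {Q : Memory → Prop} {B : ℕ}
    (hp : (Cmd.cond b p q).straight = true) (h1 : b.Holds m → Q (p.run m))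
    (h2 : ¬ b.Holds m → Q (q.run m)) (hB : (Cmd.cond b p q).cost ≤ B := by decide) :
    Runs (.cond b p q) m B Q := by
  refine Runs.straight hp ?_ hB
  rw [Cmd.run]
  split_ifs with hb
  · exact h1 hb
  · exact h2 hb

/-! ## Counting loops -/

namespace Cmd

/-- `for x < n do p`, where register `0` holds `n`. -/
def forN (x : ℕ) (p : Cmd) : Cmd :=
  seq (set x (.lit 0)) (loop (.le (.add (.reg x) (.lit 1)) (.reg 0))
    (seq p (set x (.add (.reg x) (.lit 1)))))

/-- `for x, y < n do p`, where register `0` holds `n`. -/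
def forN₂ (x y : ℕ) (p : Cmd) : Cmd := forN x (forN y p)

/-- `for x < n do p`, but only for `x` with entry `0` in array `0`. -/
def forT (x : ℕ) (p : Cmd) : Cmd :=
  forN x (cond (.le (.get 0 (.reg x)) (.lit 0)) p skip)

end Cmd

namespace Runs

variable {p : Cmd} {m : Memory} {n x y B : ℕ}

/-- The bound varies with the iteration so that `forT` can charge the full price for targets only.
The invariant must ignore the counter `x`, hence `hInv`. -/
theorem forN_sum (Inv : ℕ → Memory → Prop) (B : ℕ → ℕ) (hn : m.reg 0 = n) (hx : x ≠ 0)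
    (hpx : p.writesReg x = false) (hp : p.writesReg 0 = false)
    (hInv : ∀ k m' v, Inv k m' → Inv k (m'.setReg x v)) (h0 : Inv 0 m)
    (hstep : ∀ (i : Fin n) m', (Cmd.forN x p).Frame m m' → m'.reg x = i → Inv i m' →
      Runs p m' (B i) (Inv (i + 1))) :
    Runs (Cmd.forN x p) m (∑ i ∈ Finset.range n, (B i + 10) + 10) (Inv n) := by
  have hx0 : (Cmd.forN x p).writesReg 0 = false := by
    simp [Cmd.forN, Cmd.writesReg, hp, hx.symm]
  -- Induction on the number `j` of iterations still to come.
  have key : ∀ j k m', j + k = n → (Cmd.forN x p).Frame m m' → m'.reg x = k → Inv k m' →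
      Runs (.loop (.le (.add (.reg x) (.lit 1)) (.reg 0))
        (.seq p (.set x (.add (.reg x) (.lit 1))))) m'
        (∑ i ∈ Finset.Ico k n, (B i + 10) + 6) (Inv n) := by
    intro j
    induction j with
    | zero =>
      rintro k m' hjk hf hk hI
      have h0 : m'.reg 0 = n := (hf.reg 0 hx0).trans hn
      obtain rfl : k = n := by omega
      refine ⟨_, _, .loop_false ?_, ?_, hI⟩
      · simp [Test.Holds, Expr.eval, hk, h0]
      · simp [Test.time, Expr.time]
    | succ j ih =>
      rintro k m' hjk hf hk hI
      have h0 : m'.reg 0 = n := (hf.reg 0 hx0).trans hn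
      have hkn : k < n := by omega
      obtain ⟨t, m₁, h1, h2, h3⟩ := hstep ⟨k, hkn⟩ m' hf hk hI
      have hr : m₁.reg x = k := (h1.frame.reg x hpx).trans hk
      have hex := Exec.seq h1 (.set x (.add (.reg x) (.lit 1)) m₁)
      have hf' : (Cmd.forN x p).Frame m' (m₁.setReg x (m₁.reg x + 1)) :=
        hex.frame.of_le (by simp [Cmd.forN, Cmd.writesReg]) (by simp [Cmd.forN, Cmd.writesArr])
      obtain ⟨t', m₂, g1, g2, g3⟩ := ih (k + 1) (m₁.setReg x (m₁.reg x + 1)) (by omega)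
        (hf.trans hf') (by simp [hr]) (hInv _ _ _ h3)
      refine ⟨_, _, .loop_true ?_ hex g1, ?_, g3⟩
      · simp only [Test.Holds, Expr.eval, hk, h0]
        omega
      · rw [Finset.sum_eq_sum_Ico_succ_bot hkn]
        simp only [Test.time, Expr.time]
        simp only at h2
        omega
  have hset := Exec.set x (.lit 0) m
  obtain ⟨t, m', h1, h2, h3⟩ := key n 0 (m.setReg x 0) (by omega)
    (hset.frame.of_le (by simp +contextual [Cmd.forN, Cmd.writesReg])
      (by simp [Cmd.writesArr])) (by simp) (hInv _ _ _ h0)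
  refine ⟨_, _, .seq hset h1, ?_, h3⟩
  rw [← Finset.range_eq_Ico] at h2
  simp only [Expr.time]
  omega

theorem forN (Inv : ℕ → Memory → Prop) (hn : m.reg 0 = n) (hn1 : 1 ≤ n) (hx : x ≠ 0)
    (hpx : p.writesReg x = false) (hp : p.writesReg 0 = false)
    (hInv : ∀ k m' v, Inv k m' → Inv k (m'.setReg x v)) (h0 : Inv 0 m)
    (hstep : ∀ (i : Fin n) m', (Cmd.forN x p).Frame m m' → m'.reg x = i → Inv i m' →
      Runs p m' B (Inv (i + 1))) :
    Runs (Cmd.forN x p) m ((B + 20) * n) (Inv n) := by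
  refine (forN_sum Inv (fun _ => B) hn hx hpx hp hInv h0 hstep).le ?_
  simp only [Finset.sum_const, Finset.card_range, smul_eq_mul]
  nlinarith

/-- The invariant is indexed by the single number `u * n + v`, the count of matrix cells already
visited in row-major order. -/
theorem forN₂ (Inv : ℕ → Memory → Prop) (hn : m.reg 0 = n) (hn1 : 1 ≤ n) (hx : x ≠ 0)
    (hy : y ≠ 0) (hxy : x ≠ y) (hpx : p.writesReg x = false) (hpy : p.writesReg y = false)
    (hp : p.writesReg 0 = false)
    (hInv : ∀ k m' v, Inv k m' → Inv k (m'.setReg x v) ∧ Inv k (m'.setReg y v)) (h0 : Inv 0 m)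
    (hstep : ∀ (u v : Fin n) m', (Cmd.forN₂ x y p).Frame m m' → m'.reg x = u → m'.reg y = v →
      Inv (u * n + v) m' → Runs p m' B (Inv (u * n + v + 1))) :
    Runs (Cmd.forN₂ x y p) m ((B + 40) * n ^ 2) (Inv (n * n)) := by
  have hpy' : (Cmd.forN y p).writesReg x = false := by
    simp [Cmd.forN, Cmd.writesReg, hpx, hxy]
  have hpx' : (Cmd.forN₂ x y p).writesReg 0 = false := by
    simp [Cmd.forN₂, Cmd.forN, Cmd.writesReg, hp, hx.symm, hy.symm]
  refine (forN (B := (B + 20) * n) (fun k => Inv (k * n)) hn hn1 hx hpy'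
    (by simp [Cmd.forN, Cmd.writesReg, hp, hy.symm]) (fun k m' v h => (hInv _ _ _ h).1)
    (by simpa using h0) ?_).le ?_
  · intro u m' hf hu hI
    have := forN (p := p) (m := m') (x := y) (n := n) (B := B) (fun k => Inv (u * n + k))
      ((hf.reg 0 hpx').trans hn) hn1 hy hpy hp (fun k m' v h => (hInv _ _ _ h).2) hI ?_
    · refine this.mono le_rfl fun m'' h => ?_
      rwa [Nat.succ_mul]
    · intro v m'' hf' hv hI'
      refine hstep u v m'' (hf.trans (hf'.of_le ?_ ?_)) ((hf'.reg x hpy').trans hu) hv hI'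
      · simp +contextual [Cmd.forN, Cmd.writesReg]
      · simp +contextual [Cmd.forN, Cmd.writesArr]
  · nlinarith

/-- Vertices of `I` cost only constant time. This makes the nested loops depend on `|V'|` instead of
`n`, which the cubic bound needs when `V'` is small. -/
theorem forT (P : Input (Fin n)) (Inv : ℕ → Memory → Prop) (hn : m.reg 0 = n) (hn1 : 1 ≤ n)
    (hI : ∀ v : Fin n, m.arr 0 v = if v ∈ P.I then 1 else 0) (hx : x ≠ 0)
    (hpx : p.writesReg x = false) (hp : p.writesReg 0 = false) (hpI : p.writesArr 0 = false)
    (hInv : ∀ k m' v, Inv k m' → Inv k (m'.setReg x v)) (h0 : Inv 0 m)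
    (hskip : ∀ (i : Fin n) m', (Cmd.forT x p).Frame m m' → i ∉ P.targets → Inv i m' →
      Inv (i + 1) m')
    (hstep : ∀ (i : Fin n) m', (Cmd.forT x p).Frame m m' → m'.reg x = i → i ∈ P.targets →
      Inv i m' → Runs p m' B (Inv (i + 1))) :
    Runs (Cmd.forT x p) m (P.targets.card * B + 26 * n) (Inv n) := by
  have hpI' : (Cmd.forT x p).writesArr 0 = false := by
    simp [Cmd.forT, Cmd.forN, Cmd.writesArr, hpI]
  refine (forN_sum Inv (fun i => (if ∃ v ∈ P.targets, (v : ℕ) = i then B else 0) + 6) hn hx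
    (by simp [Cmd.writesReg, hpx]) (by simp [Cmd.writesReg, hp]) hInv h0 ?_).le ?_
  · intro i m' hf hi h
    have h0 : m'.arr 0 i = if i ∈ P.I then 1 else 0 := by
      rw [hf.arr 0 hpI', hI]
    have hholds : (Test.le (.get 0 (.reg x)) (.lit 0)).Holds m' ↔ i ∈ P.targets := by
      simp [Test.Holds, Expr.eval, hi, h0, Input.targets]
    by_cases hit : i ∈ P.targets
    · obtain ⟨t, m'', h1, h2, h3⟩ := hstep i m' hf hi hit h
      refine ⟨_, _, .cond_true (hholds.2 hit) h1, ?_, h3⟩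
      rw [if_pos ⟨i, hit, rfl⟩]
      simp only [Test.time, Expr.time]
      omega
    · refine ⟨_, _, .cond_false (fun hc => hit (hholds.1 hc)) (.skip m'), ?_, hskip i m' hf hit h⟩
      simp only [Test.time, Expr.time]
      omega
  · rw [Finset.sum_range]
    have : ∀ i : Fin n, (∃ v ∈ P.targets, (v : ℕ) = i) ↔ i ∈ P.targets := fun i =>
      ⟨fun ⟨v, hv, hvi⟩ => Fin.ext hvi ▸ hv, fun h => ⟨i, h, rfl⟩⟩
    simp only [this, Finset.sum_add_distrib, Finset.sum_ite_mem, Finset.univ_inter,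
      Finset.sum_const, smul_eq_mul, Finset.card_univ, Fintype.card_fin]
    omega

end Runs

/-! ## Adjacency matrices -/

section Cells

variable {n : ℕ}

theorem cell_inj (u v u' v' : Fin n) : (u : ℕ) * n + v = u' * n + v' ↔ u = u' ∧ v = v' := by
  refine ⟨fun h => ?_, by rintro ⟨rfl, rfl⟩; rfl⟩
  have h1 : (u : ℕ) = u' := by
    have := congrArg (· / n) h
    have hn : 0 < n := u.pos
    simpa [Nat.add_comm, Nat.add_mul_div_right _ _ hn, Nat.div_eq_of_lt] using this
  exact ⟨Fin.ext h1, Fin.ext (by rw [h1] at h; omega)⟩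

theorem cell_lt (u v : Fin n) : (u : ℕ) * n + v < n * n := by
  have : (u + 1 : ℕ) * n ≤ n * n := Nat.mul_le_mul_right _ u.2
  rw [Nat.succ_mul] at this
  omega

/-- The induction step of every matrix scan: a visited cell was visited before or is the current
one. -/
theorem cell_lt_succ (u v u' v' : Fin n) : (u : ℕ) * n + v < u' * n + v' + 1 ↔
    (u : ℕ) * n + v < u' * n + v' ∨ u = u' ∧ v = v' := by
  rw [← cell_inj]
  omega

end Cells

/-! ### Matrix access and the data kept fixed throughout. -/

/-- The test that the value of `e` is positive. -/
def Test.pos (e : Expr) : Test := .le (.lit 1) e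

/-- The test for equality. -/
def Test.eq (e e' : Expr) : Test := .both (.le e e') (.le e' e)

@[simp] theorem Test.pos_holds {e : Expr} {m : Memory} : (Test.pos e).Holds m ↔ 1 ≤ e.eval m :=
  Iff.rfl

@[simp] theorem Test.eq_holds {e e' : Expr} {m : Memory} :
    (Test.eq e e').Holds m ↔ e.eval m = e'.eval m :=
  antisymm_iff

/-- The index of a matrix entry, whose row and column are in the registers `x` and `y`. -/
def Expr.cell (x y : ℕ) : Expr := .add (.get 6 (.reg x)) (.reg y)

/-- What is never changed after the initialization: register `0` holds `n`, register `3` holds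
`|V'| + 1`, array `0` is the indicator of `I`, array `6` holds the indices of the rows of a matrix,
and the table holds the costs. -/
structure Setup {n : ℕ} (P : Input (Fin n)) (m : Memory) : Prop where
  size : m.reg 0 = n
  bound : m.reg 3 = P.targets.card + 1
  indicator : ∀ v : Fin n, m.arr 0 v = if v ∈ P.I then 1 else 0
  row : ∀ u : Fin n, m.arr 6 u = u * n
  table : ∀ e : Fin n × Fin n, m.table (e.1 * n + e.2) = P.cost e

section Programs

variable {n : ℕ} {P : Input (Fin n)} {E : Finset (Fin n × Fin n)} {m m' : Memory}

theorem Setup.frame {p : Cmd} (h : Setup P m) (hf : p.Frame m m')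
    (h0 : p.writesReg 0 = false := by rfl) (h3 : p.writesReg 3 = false := by rfl)
    (ha0 : p.writesArr 0 = false := by rfl) (ha6 : p.writesArr 6 = false := by rfl) :
    Setup P m' :=
  ⟨(hf.reg 0 h0).trans h.size, (hf.reg 3 h3).trans h.bound, fun v => hf.arr 0 ha0 ▸ h.indicator v,
    fun v => hf.arr 6 ha6 ▸ h.row v, fun e => hf.table ▸ h.table e⟩

theorem HoldsEdges.frame {p : Cmd} (h : HoldsEdges m 4 E) (hf : p.Frame m m')
    (ha : p.writesArr 4 = false := by rfl) : HoldsEdges m' 4 E := fun u v => by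
  rw [hf.arr 4 ha, h u v]

theorem HoldsEdges.pos_iff {a : ℕ} (h : HoldsEdges m a E) (u v : Fin n) :
    1 ≤ m.arr a (u * n + v) ↔ (u, v) ∈ E := by
  rw [h u v]
  split_ifs with hE <;> simp [hE]

theorem Setup.eval_cell (h : Setup P m) {x y : ℕ} {u v : Fin n} (hu : m.reg x = u)
    (hv : m.reg y = v) : (Expr.cell x y).eval m = u * n + v := by
  simp [Expr.cell, Expr.eval, hu, hv, h.row]

theorem Setup.one_le (_ : Setup P m) : 1 ≤ n := by
  obtain ⟨v, -⟩ := P.targets_nonempty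
  exact v.pos

theorem Setup.pos_indicator (h : Setup P m) (v : Fin n) : 1 ≤ m.arr 0 v ↔ v ∈ P.I := by
  rw [h.indicator]
  split_ifs with hI <;> simp [hI]

theorem mem_targets {v : Fin n} : v ∈ P.targets ↔ v ∉ P.I := by simp [Input.targets]

/-! ### The initialization -/

/-- Compute the row indices and the number of targets. -/
def rows : Cmd :=
  .seq (.set 3 (.lit 1)) <| Cmd.forN 4 <|
    .seq (.put 6 (.reg 4) (.reg 13)) <| .seq (.set 13 (.add (.reg 13) (.reg 0))) <|
      .cond (.le (.get 0 (.reg 4)) (.lit 0)) (.set 3 (.add (.reg 3) (.lit 1))) .skip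

theorem runs_rows (P : Input (Fin n)) : Runs rows (load P) (80 * n) (Setup P) := by
  have hn : 1 ≤ n := by
    obtain ⟨v, -⟩ := P.targets_nonempty
    exact v.pos
  -- Register `13` accumulates `k * n` by repeated addition, since the machine cannot multiply.
  let Inv : ℕ → Memory → Prop := fun k m => (∀ u : Fin n, (u : ℕ) < k → m.arr 6 u = u * n) ∧
    m.reg 13 = k * n ∧ m.reg 3 = (P.targets.filter fun u : Fin n => (u : ℕ) < k).card + 1
  have hind : ∀ v : Fin n, (load P).arr 0 v = if v ∈ P.I then 1 else 0 := fun v => by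
    have : (∃ w ∈ P.I, (w : ℕ) = v) ↔ v ∈ P.I :=
      ⟨fun ⟨w, hw, h⟩ => Fin.ext h ▸ hw, fun h => ⟨v, h, rfl⟩⟩
    simp [load, this]
  refine (Runs.seq (B := 2) (B' := 70 * n) (Runs.set fun hf => ?_)).le (by omega)
  · refine ((Runs.forN (n := n) (B := 50) Inv (hf.reg 0 rfl) hn (by decide) rfl rfl ?_ ?_ ?_).frame).mono le_rfl ?_
    · intro k m' v h
      simpa [Inv] using h
    · simp [Inv, load, Expr.eval]
    · intro i m' hf' hi ⟨h1, h2, h3⟩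
      refine Runs.straight rfl ?_
      have hn' : m'.reg 0 = n := (hf'.reg 0 rfl).trans (hf.reg 0 rfl)
      have hI : m'.arr 0 i = if i ∈ P.I then 1 else 0 := by
        rw [hf'.arr 0 rfl, hf.arr 0 rfl, hind]
      have hcard : (P.targets.filter fun u : Fin n => (u : ℕ) < i + 1).card =
          (P.targets.filter fun u : Fin n => (u : ℕ) < i).card + if i ∈ P.targets then 1 else 0 := by
        split_ifs with hit
        · rw [← Finset.card_insert_of_notMem (a := i) (by simp)]
          congr 1
          ext u
          simp only [Finset.mem_filter, Finset.mem_insert, Fin.ext_iff, Nat.lt_succ_iff,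
            le_iff_lt_or_eq]
          constructor
          · tauto
          · rintro (h | h)
            · exact ⟨Fin.ext h ▸ hit, .inr h⟩
            · exact ⟨h.1, .inl h.2⟩
        · congr 1
          ext u
          simp only [Finset.mem_filter, Nat.lt_succ_iff, le_iff_lt_or_eq]
          constructor
          · rintro ⟨hu, h | h⟩
            · exact ⟨hu, h⟩
            · exact absurd (Fin.ext h ▸ hu) hit
          · exact fun h => ⟨h.1, .inl h.2⟩
      have h6 : ∀ u : Fin n, (u : ℕ) < i + 1 → (if (u : ℕ) = i then (i : ℕ) * n else m'.arr 6 u) =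
          u * n := by
        intro u hu
        split_ifs with hui
        · rw [hui]
        · exact h1 u (by omega)
      by_cases hiI : i ∈ P.I
      · simp [Inv, Cmd.run, Expr.eval, Test.Holds, hi, hI, hiI, h2, h3, hn', Nat.succ_mul,
          mem_targets] at hcard ⊢
        simpa [← hcard] using h6
      · simp [Inv, Cmd.run, Expr.eval, Test.Holds, hi, hI, hiI, h2, h3, hn', Nat.succ_mul,
          mem_targets] at hcard ⊢
        simpa [← hcard] using h6
    · rintro m' ⟨hf', h1, -, h3⟩
      refine ⟨(hf'.reg 0 rfl).trans (hf.reg 0 rfl), ?_, fun v => ?_, fun u => h1 u u.2, fun e => ?_⟩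
      · rw [h3, Finset.filter_true_of_mem fun u _ => u.2]
      · rw [hf'.arr 0 rfl, hf.arr 0 rfl, hind]
      · rw [hf'.table, hf.table]
        have : ∀ a : Fin n × Fin n, ((a.1 : ℕ) * n + a.2 = e.1 * n + e.2) ↔ a = e := fun a => by
          rw [cell_inj, Prod.ext_iff]
        simp [load, this]

/-- Write the adjacency matrix of the input graph. -/
def fillEdges : Cmd :=
  Cmd.forN₂ 4 5 <| .cond (.both (.pos (.get 0 (.reg 4))) (.pos (.get 0 (.reg 5)))) .skip
    (.put 4 (.cell 4 5) (.lit 1))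

theorem runs_fillEdges (hm : Setup P m) (h4 : ∀ j, m.arr 4 j = 0) :
    Runs fillEdges m (90 * n ^ 2) fun m' => HoldsEdges m' 4 P.edges := by
  refine (Runs.forN₂ (n := n) (B := 50) (fun k m' => ∀ u v : Fin n,
    m'.arr 4 (u * n + v) = if (u, v) ∈ P.edges ∧ (u : ℕ) * n + v < k then 1 else 0)
    hm.size hm.one_le (by decide) (by decide) (by decide) rfl rfl rfl ?_ ?_ ?_).mono le_rfl ?_
  · intro k m' v h
    exact ⟨h, h⟩
  · simp [h4]
  · intro u v m' hf hu hv h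
    have hm' := hm.frame hf
    refine Runs.straight rfl fun a b => ?_
    have hE : (u, v) ∈ P.edges ↔ ¬ (u ∈ P.I ∧ v ∈ P.I) := by simp [Input.edges]
    simp only [cell_lt_succ]
    by_cases huv : (u, v) ∈ P.edges
    · have := hE.1 huv
      simp only [Cmd.run, Test.Holds, Test.pos_holds, Expr.eval, hu, hv, hm'.pos_indicator,
        this, if_false, hm'.eval_cell hu hv, Memory.setArr_apply, true_and, cell_inj, h]
      by_cases hab : a = u ∧ b = v
      · obtain ⟨rfl, rfl⟩ := hab
        simp [huv]
      · simp [hab]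
    · have := not_not.1 (mt hE.2 huv)
      simp only [Cmd.run, Test.Holds, Test.pos_holds, Expr.eval, hu, hv, hm'.pos_indicator,
        this, if_true, h, true_and]
      by_cases hab : a = u ∧ b = v
      · obtain ⟨rfl, rfl⟩ := hab
        simp [huv]
      · simp [hab]
  · intro m' h u v
    rw [h u v]
    simp [cell_lt]

/-! ### The reachability relation -/

/-- `Walk E W k u v`: in the subgraph induced on `W` there is a walk from `u` to `v` all of whose
inner vertices are less than `k`. -/
def Walk (E : Finset (Fin n × Fin n)) (W : Finset (Fin n)) : ℕ → Fin n → Fin n → Prop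
  | 0, u, v => u ∈ W ∧ v ∈ W ∧ (u = v ∨ (u, v) ∈ E)
  | k + 1, u, v => Walk E W k u v ∨ ∃ w : Fin n, (w : ℕ) = k ∧ Walk E W k u w ∧ Walk E W k w v

section Walk

variable {W : Finset (Fin n)}

theorem Walk.mem {k : ℕ} {u v : Fin n} (h : Walk E W k u v) : u ∈ W ∧ v ∈ W := by
  induction k generalizing u v with
  | zero => exact ⟨h.1, h.2.1⟩
  | succ k ih =>
    obtain h | ⟨w, -, h1, h2⟩ := h
    · exact ih h
    · exact ⟨(ih h1).1, (ih h2).2⟩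

/-- If `w` is the top vertex `k`, both walks can be shortened so that `k` is not an inner vertex,
and `w` becomes the splitting point. If `w` is smaller, split the walks at `k`; when both pass
through `k`, the detour between the two visits is cut out. -/
theorem Walk.trans {k : ℕ} {u v w : Fin n} (hw : (w : ℕ) < k) (h : Walk E W k u w)
    (h' : Walk E W k w v) : Walk E W k u v := by
  induction k generalizing u v w with
  | zero => omega
  | succ k ih =>
    by_cases hwk : (w : ℕ) = k
    · have h1 : Walk E W k u w := by
        obtain h | ⟨x, hx, h1, h2⟩ := h
        · exact h
        · rwa [Fin.ext (hx.trans hwk.symm)] at h1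
      have h2 : Walk E W k w v := by
        obtain h | ⟨x, hx, h1, h2⟩ := h'
        · exact h
        · rwa [Fin.ext (hx.trans hwk.symm)] at h2
      exact .inr ⟨w, hwk, h1, h2⟩
    · have hlt : (w : ℕ) < k := by omega
      obtain h | ⟨x, hx, h1, h2⟩ := h <;> obtain h' | ⟨y, hy, h1', h2'⟩ := h'
      · exact .inl (ih hlt h h')
      · exact .inr ⟨y, hy, ih hlt h h1', h2'⟩
      · exact .inr ⟨x, hx, h1, ih hlt h2 h'⟩
      · obtain rfl : x = y := Fin.ext (hx.trans hy.symm)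
        exact .inr ⟨x, hx, h1, h2'⟩

theorem Walk.mono {k l : ℕ} (hkl : k ≤ l) {u v : Fin n} (h : Walk E W k u v) : Walk E W l u v := by
  induction hkl with
  | refl => exact h
  | step _ ih => exact .inl ih

/-- An edge has no inner vertices, and below the bound `n` every vertex is allowed as one, so edges
may be concatenated freely. -/
theorem walk_of_reach {u v : Fin n} (hu : u ∈ W) (h : Reach E W u v) : Walk E W n u v := by
  induction h with
  | refl => exact Walk.mono (Nat.zero_le n) ⟨hu, hu, .inl rfl⟩
  | @tail b c _ hbc ih =>
    exact Walk.trans b.2 ih (Walk.mono (Nat.zero_le n) ⟨hbc.2.1, hbc.2.2, .inr hbc.1⟩)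

end Walk

/-- Compute the reachability relation of the subgraph induced on the targets. -/
def closure : Cmd :=
  .seq (Cmd.forN₂ 4 5 <|
    .cond (.both (.both (.neg (.pos (.get 0 (.reg 4)))) (.neg (.pos (.get 0 (.reg 5)))))
      (.neg (.both (.neg (.eq (.reg 4) (.reg 5))) (.neg (.pos (.get 4 (.cell 4 5)))))))
      (.put 7 (.cell 4 5) (.lit 1)) (.put 7 (.cell 4 5) (.lit 0))) <|
  Cmd.forT 6 <| Cmd.forN₂ 4 5 <|
    .cond (.both (.pos (.get 7 (.cell 4 6))) (.pos (.get 7 (.cell 6 5))))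
      (.put 7 (.cell 4 5) (.lit 1)) .skip

/-- Array `7` holds the reachability relation. -/
def HoldsReach (P : Input (Fin n)) (E : Finset (Fin n × Fin n)) (m : Memory) : Prop :=
  ∀ u v : Fin n, 1 ≤ m.arr 7 (u * n + v) ↔
    u ∈ P.targets ∧ v ∈ P.targets ∧ Reach E P.targets u v

/-- Warshall's algorithm in place. The invariant is two one-sided statements: positive entries are
truly reachable pairs, and walks with inner vertices below `k` have positive entries. Overwriting
entries during a round can only reveal reachability early, so it does no harm. -/
theorem runs_closure (hm : Setup P m) (hE : HoldsEdges m 4 E) :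
    Runs closure m (210 * (P.targets.card * n ^ 2)) (HoldsReach P E) := by
  refine (Runs.seq (B := 90 * n ^ 2) (B' := P.targets.card * (90 * n ^ 2) + 26 * n) ?_).le ?_
  · refine (Runs.forN₂ (n := n) (B := 50) (fun k m' => ∀ u v : Fin n, (u : ℕ) * n + v < k →
      (1 ≤ m'.arr 7 (u * n + v) ↔ Walk E P.targets 0 u v))
      hm.size hm.one_le (by decide) (by decide) (by decide) rfl rfl rfl ?_ ?_ ?_).mono le_rfl ?_
    · intro k m' v h
      exact ⟨h, h⟩
    · intro u v h
      omega
    · intro u v m' hf hu hv h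
      have hm' := hm.frame hf
      have hE' := hE.frame hf
      have hw : (Walk E P.targets 0 u v) ↔ (¬ u ∈ P.I ∧ ¬ v ∈ P.I) ∧ ¬ (¬ u = v ∧ ¬ (u, v) ∈ E) := by
        simp only [Walk, mem_targets]
        tauto
      refine Runs.branch rfl (fun hc a b hab => ?_) (fun hc a b hab => ?_) <;>
      · simp only [Test.Holds, Test.pos_holds, Test.eq_holds, Expr.eval, hu, hv,
          hm'.pos_indicator, hm'.eval_cell hu hv, hE'.pos_iff, ← Fin.ext_iff, ← hw] at hc
        rw [cell_lt_succ] at hab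
        simp only [Cmd.run, Expr.eval, hm'.eval_cell hu hv, Memory.setArr_apply, true_and, cell_inj]
        obtain hab | ⟨rfl, rfl⟩ := hab
        · by_cases hab' : a = u ∧ b = v
          · obtain ⟨rfl, rfl⟩ := hab'
            simp [hc]
          · simpa [hab'] using h a b hab
        · simp [hc]
    · intro m₁ h hf
      have hm₁ := hm.frame hf
      refine (Runs.forT P (fun k m' => (∀ u v : Fin n, 1 ≤ m'.arr 7 (u * n + v) →
        u ∈ P.targets ∧ v ∈ P.targets ∧ Reach E P.targets u v) ∧
        ∀ u v : Fin n, Walk E P.targets k u v → 1 ≤ m'.arr 7 (u * n + v))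
        hm₁.size hm₁.one_le hm₁.indicator (by decide) rfl rfl rfl ?_ ?_ ?_ ?_).mono le_rfl ?_
      · intro k m' v h
        exact h
      · refine ⟨fun u v huv => ?_, fun u v huv => (h u v (cell_lt u v)).2 huv⟩
        obtain ⟨h1, h2, h3⟩ := (h u v (cell_lt u v)).1 huv
        refine ⟨h1, h2, ?_⟩
        obtain rfl | h3 := h3
        · exact .refl
        · exact .single ⟨h3, h1, h2⟩
      -- A walk in `V'` has no inner vertex in `I`, so rounds for vertices of `I` may be skipped.
      · rintro i m' - hi ⟨hs, hc⟩
        refine ⟨hs, fun u v huv => ?_⟩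
        obtain huv | ⟨w, hw, h1, -⟩ := huv
        · exact hc u v huv
        · exact absurd (Fin.ext hw ▸ h1.mem.2) hi
      · rintro w m₂ hf₂ hw - ⟨hs, hc⟩
        have hm₂ := hm₁.frame hf₂
        refine (Runs.forN₂ (n := n) (B := 50) (fun k m' => ((∀ u v : Fin n, 1 ≤ m'.arr 7 (u * n + v) →
          u ∈ P.targets ∧ v ∈ P.targets ∧ Reach E P.targets u v) ∧
          ∀ u v : Fin n, Walk E P.targets w u v → 1 ≤ m'.arr 7 (u * n + v)) ∧
          ∀ u v : Fin n, (u : ℕ) * n + v < k →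
            Walk E P.targets (w + 1) u v → 1 ≤ m'.arr 7 (u * n + v))
          hm₂.size hm₂.one_le (by decide) (by decide) (by decide) rfl rfl rfl ?_ ?_ ?_).mono
          le_rfl ?_
        · intro k m' v h
          exact ⟨h, h⟩
        · exact ⟨⟨hs, hc⟩, fun u v h => by omega⟩
        · rintro u v m₃ hf₃ hu hv ⟨⟨hs₃, hc₃⟩, hd₃⟩
          have hm₃ := hm₂.frame hf₃
          have hw₃ : m₃.reg 6 = w := (hf₃.reg 6 rfl).trans hw
          refine Runs.straight rfl ?_
          simp only [Cmd.run, Test.Holds, Test.pos_holds, Expr.eval,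
            hm₃.eval_cell hu hv, hm₃.eval_cell hu hw₃, hm₃.eval_cell hw₃ hv]
          split_ifs with hcond
          · simp only [Memory.setArr_apply, true_and, cell_inj]
            refine ⟨⟨fun a b hab => ?_, fun a b hab => ?_⟩, fun a b hlt hab => ?_⟩
            · split_ifs at hab with hab'
              · obtain ⟨rfl, rfl⟩ := hab'
                have h1 := hs₃ _ _ hcond.1
                have h2 := hs₃ _ _ hcond.2
                exact ⟨h1.1, h2.2.1, h1.2.2.trans h2.2.2⟩
              · exact hs₃ _ _ hab
            · split_ifs
              · rfl
              · exact hc₃ _ _ hab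
            · split_ifs with hab'
              · rfl
              · exact hd₃ _ _ (((cell_lt_succ _ _ _ _).1 hlt).resolve_right hab') hab
          -- The cell is left alone. A new walk through `w` would have made both tested entries
          -- positive.
          · refine ⟨⟨hs₃, hc₃⟩, fun a b hlt hab => ?_⟩
            obtain hlt | ⟨rfl, rfl⟩ := (cell_lt_succ _ _ _ _).1 hlt
            · exact hd₃ _ _ hlt hab
            · obtain hab | ⟨x, hx, h1, h2⟩ := hab
              · exact hc₃ _ _ hab
              · obtain rfl := Fin.ext hx
                exact absurd ⟨hc₃ _ _ h1, hc₃ _ _ h2⟩ hcond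
        · rintro m' ⟨⟨hs', -⟩, hd'⟩
          exact ⟨hs', fun u v huv => hd' u v (cell_lt u v) huv⟩
      · rintro m' ⟨hs, hc⟩ u v
        exact ⟨hs u v, fun h => hc u v (walk_of_reach h.1 h.2.2)⟩
  · have h1 : 1 ≤ P.targets.card := P.targets_nonempty.card_pos
    have h2 := hm.one_le
    nlinarith [Nat.mul_le_mul h1 (Nat.mul_le_mul h2 (le_refl n)), Nat.mul_le_mul_right (n ^ 2) h1]

/-! ### Representatives of the components, and the bipartite graph -/

/-- `ρ` selects one vertex from every component. -/
structure IsSelector (P : Input (Fin n)) (E : Finset (Fin n × Fin n)) (ρ : Fin n → Fin n) :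
    Prop where
  mem : ∀ q ∈ P.targets, ρ q ∈ P.targets
  component : ∀ q ∈ P.targets, component E P.targets (ρ q) = component E P.targets q
  eq : ∀ q ∈ P.targets, ∀ q' ∈ P.targets,
    SCCMatching.component E P.targets q = SCCMatching.component E P.targets q' → ρ q = ρ q'

theorem IsSelector.idem {ρ : Fin n → Fin n} (h : IsSelector P E ρ) {q : Fin n}
    (hq : q ∈ P.targets) : ρ (ρ q) = ρ q :=
  h.eq _ (h.mem q hq) _ hq (h.component q hq)

theorem IsSelector.mem_component {ρ : Fin n → Fin n} (h : IsSelector P E ρ) {r v : Fin n}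
    (hr : r ∈ P.targets) (hrr : ρ r = r) :
    v ∈ SCCMatching.component E P.targets r ↔ v ∈ P.targets ∧ ρ v = r := by
  constructor
  · intro hv
    have hvt := (SCCMatching.mem_component.1 hv).1
    exact ⟨hvt, (h.eq v hvt r hr (component_eq hv)).trans hrr⟩
  · rintro ⟨hv, rfl⟩
    rw [h.component v hv]
    exact self_mem_component hv

/-- Compute representatives of the components of the subgraph induced on the targets. -/
def selector : Cmd :=
  Cmd.forN₂ 4 5 <| .cond (.both (.pos (.get 7 (.cell 4 5))) (.pos (.get 7 (.cell 5 4))))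
    (.put 8 (.reg 4) (.reg 5)) .skip

/-- Columns are scanned in increasing order and later hits overwrite earlier ones, so `ρ q` is the
largest vertex of the component of `q`. It therefore depends on the component only. -/
theorem runs_selector (hm : Setup P m) (hR : HoldsReach P E m) :
    Runs selector m (90 * n ^ 2) fun m' =>
      ∃ ρ, IsSelector P E ρ ∧ ∀ q ∈ P.targets, m'.arr 8 q = ρ q := by
  have hcomp : ∀ q u : Fin n, (1 ≤ m.arr 7 (q * n + u) ∧ 1 ≤ m.arr 7 (u * n + q)) ↔
      q ∈ P.targets ∧ u ∈ P.targets ∧ component E P.targets u = component E P.targets q := by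
    intro q u
    rw [hR, hR]
    constructor
    · rintro ⟨⟨hq, hu, h1⟩, -, -, h2⟩
      exact ⟨hq, hu, (component_eq_iff hu).2 ⟨h1, h2⟩⟩
    · rintro ⟨hq, hu, h⟩
      obtain ⟨h1, h2⟩ := (component_eq_iff hu).1 h
      exact ⟨⟨hq, hu, h1⟩, hu, hq, h2⟩
  -- The clause `u ≤ r` records that the stored vertex dominates every member seen so far.
  refine (Runs.forN₂ (n := n) (B := 50) (fun k m' => ∀ q ∈ P.targets, ∀ u ∈ P.targets,
    component E P.targets u = component E P.targets q → (q : ℕ) * n + u < k →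
    ∃ r : Fin n, m'.arr 8 q = r ∧ r ∈ P.targets ∧
      component E P.targets r = component E P.targets q ∧ u ≤ r)
    hm.size hm.one_le (by decide) (by decide) (by decide) rfl rfl rfl ?_ ?_ ?_).mono le_rfl ?_
  · intro k m' v h
    exact ⟨h, h⟩
  · intro q _ u _ _ h
    omega
  · intro a b m' hf ha hb h
    have hm' := hm.frame hf
    refine Runs.branch rfl (fun hc q hq u hu hqu hlt => ?_) (fun hc q hq u hu hqu hlt => ?_)
    · simp only [Test.Holds, Test.pos_holds, Expr.eval, hm'.eval_cell ha hb, hm'.eval_cell hb ha,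
        hf.arr 7 rfl, hcomp] at hc
      simp only [Cmd.run, Expr.eval, ha, hb, Memory.setArr_apply, true_and, ← Fin.ext_iff]
      rw [cell_lt_succ] at hlt
      by_cases hqa : q = a
      · subst hqa
        refine ⟨b, by simp, hc.2.1, hc.2.2, ?_⟩
        obtain hlt | ⟨-, rfl⟩ := hlt
        · exact Fin.le_def.2 (by omega)
        · exact le_rfl
      · simp only [hqa, if_false]
        exact h q hq u hu hqu (hlt.resolve_right fun hc => hqa hc.1)
    · simp only [Test.Holds, Test.pos_holds, Expr.eval, hm'.eval_cell ha hb, hm'.eval_cell hb ha,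
        hf.arr 7 rfl, hcomp] at hc
      rw [cell_lt_succ] at hlt
      refine h q hq u hu hqu (hlt.resolve_right ?_)
      rintro ⟨rfl, rfl⟩
      exact hc ⟨hq, hu, hqu⟩
  · intro m' h
    have hex : ∀ q ∈ P.targets, ∃ r : Fin n, m'.arr 8 q = r ∧ r ∈ P.targets ∧
        component E P.targets r = component E P.targets q :=
      fun q hq =>
        let ⟨r, h1, h2, h3, _⟩ := h q hq q hq rfl (cell_lt q q)
        ⟨r, h1, h2, h3⟩
    have : Nonempty (Fin n) := ⟨⟨0, hm.one_le⟩⟩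
    choose! ρ h1 h2 h3 using hex
    have hle : ∀ q ∈ P.targets, ∀ q' ∈ P.targets,
        component E P.targets q = component E P.targets q' → ρ q' ≤ ρ q := by
      intro q hq q' hq' hqq
      obtain ⟨r, g1, -, -, g2⟩ := h q hq (ρ q') (h2 q' hq') ((h3 q' hq').trans hqq.symm)
        (cell_lt _ _)
      rw [h1 q hq, ← Fin.ext_iff] at g1
      exact g1 ▸ g2
    exact ⟨ρ, ⟨h2, h3, fun q hq q' hq' hqq =>
      (hle q' hq' q hq hqq.symm).antisymm (hle q hq q' hq' hqq)⟩, h1⟩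

/-- Compute which representatives have an edge from and to which vertices in `I`. -/
def adjacency : Cmd :=
  .seq (Cmd.forN₂ 4 5 (.seq (.put 9 (.cell 4 5) (.lit 0)) (.put 10 (.cell 4 5) (.lit 0)))) <|
  Cmd.forN₂ 4 5 <|
    .cond (.both (.neg (.pos (.get 0 (.reg 4)))) (.pos (.get 0 (.reg 5))))
      (.seq
        (.cond (.pos (.get 4 (.cell 4 5)))
          (.put 9 (.add (.get 6 (.get 8 (.reg 4))) (.reg 5)) (.lit 1)) .skip)
        (.cond (.pos (.get 4 (.cell 5 4)))
          (.put 10 (.add (.get 6 (.get 8 (.reg 4))) (.reg 5)) (.lit 1)) .skip))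
      .skip

/-- The arrays `9` and `10` hold the edges between components and vertices in `I`. -/
def HoldsAdjacency (P : Input (Fin n)) (E : Finset (Fin n × Fin n)) (ρ : Fin n → Fin n)
    (m : Memory) : Prop :=
  ∀ r ∈ P.targets, ρ r = r → ∀ i : Fin n,
    (1 ≤ m.arr 9 (r * n + i) ∧ 1 ≤ m.arr 10 (r * n + i)) ↔ (component E P.targets r, i) ∈ P.bip E

/-- Every target `q` enters its edges to and from `I` in the row of its representative `ρ q`. The
two directions are collected separately because they may use different vertices of the component. -/
theorem runs_adjacency (hm : Setup P m) (hE : HoldsEdges m 4 E) {ρ : Fin n → Fin n}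
    (hρ : IsSelector P E ρ) (h8 : ∀ q ∈ P.targets, m.arr 8 q = ρ q) :
    Runs adjacency m (180 * n ^ 2) (HoldsAdjacency P E ρ) := by
  refine (Runs.seq (B := 90 * n ^ 2) (B' := 90 * n ^ 2) ?_).le (by omega)
  refine (Runs.forN₂ (n := n) (B := 50) (fun k m' => ∀ r i : Fin n, (r : ℕ) * n + i < k →
    m'.arr 9 (r * n + i) = 0 ∧ m'.arr 10 (r * n + i) = 0)
    hm.size hm.one_le (by decide) (by decide) (by decide) rfl rfl rfl ?_ ?_ ?_).mono le_rfl ?_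
  · intro k m' v h
    exact ⟨h, h⟩
  · intro r i h
    omega
  · intro a b m' hf ha hb h
    have hm' := hm.frame hf
    refine Runs.straight rfl fun r i hlt => ?_
    rw [cell_lt_succ] at hlt
    have hb' : (Expr.cell 4 5).eval (m'.setArr 9 (a * n + b) 0) = a * n + b :=
      (hm'.frame (Exec.put 9 (.lit (a * n + b)) (.lit 0) m').frame).eval_cell ha hb
    simp only [Cmd.run, Expr.eval, hm'.eval_cell ha hb, hb', Memory.setArr_apply, cell_inj]
    obtain hlt | hlt := hlt
    · simp [h r i hlt]
    · simp [hlt]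
  · intro m₁ h hf₁
    have hm₁ := hm.frame hf₁
    have hE₁ := hE.frame hf₁
    refine (Runs.forN₂ (n := n) (B := 50) (fun k m' => ∀ r i : Fin n,
      (1 ≤ m'.arr 9 (r * n + i) ↔ ∃ q ∈ P.targets, ρ q = r ∧ i ∈ P.I ∧ (q, i) ∈ E ∧
        (q : ℕ) * n + i < k) ∧
      (1 ≤ m'.arr 10 (r * n + i) ↔ ∃ q ∈ P.targets, ρ q = r ∧ i ∈ P.I ∧ (i, q) ∈ E ∧
        (q : ℕ) * n + i < k))
      hm₁.size hm₁.one_le (by decide) (by decide) (by decide) rfl rfl rfl ?_ ?_ ?_).mono le_rfl ?_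
    · intro k m' v h
      exact ⟨h, h⟩
    · intro r i
      simp [h r i (cell_lt r i)]
    · intro q j m' hf hq hj h
      have hm' := hm₁.frame hf
      have hE' := hE₁.frame hf
      refine Runs.branch rfl (fun hc => ?_) (fun hc => ?_)
      · simp only [Test.Holds, Test.pos_holds, Expr.eval, hq, hj, hm'.pos_indicator,
          ← mem_targets] at hc
        obtain ⟨hqt, hjI⟩ := hc
        have h8' : m'.arr 8 q = ρ q := by rw [hf.arr 8 rfl, hf₁.arr 8 rfl, h8 q hqt]
        -- The update step for either array: `R` is the edge relation in one of the two directions,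
        -- and `C` says whether the current edge is present.
        have key : ∀ (R : Fin n → Fin n → Prop) (C : Prop) [Decidable C] (A A' : ℕ → ℕ)
            (_ : ∀ r i : Fin n, A' (r * n + i) = if C ∧ r = ρ q ∧ i = j then 1 else A (r * n + i))
            (_ : C ↔ R q j)
            (_ : ∀ r i : Fin n, 1 ≤ A (r * n + i) ↔ ∃ p ∈ P.targets, ρ p = r ∧ i ∈ P.I ∧ R p i ∧
              (p : ℕ) * n + i < q * n + j) (r i : Fin n),
            1 ≤ A' (r * n + i) ↔ ∃ p ∈ P.targets, ρ p = r ∧ i ∈ P.I ∧ R p i ∧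
              (p : ℕ) * n + i < q * n + j + 1 := by
          intro R C _ A A' hA' hC hA r i
          simp only [cell_lt_succ]
          rw [hA']
          split_ifs with hif
          · obtain ⟨hC', rfl, rfl⟩ := hif
            exact iff_of_true le_rfl ⟨q, hqt, rfl, hjI, hC.1 hC', .inr ⟨rfl, rfl⟩⟩
          · rw [hA]
            constructor
            · rintro ⟨p, h1, h2, h3, h4, h5⟩
              exact ⟨p, h1, h2, h3, h4, .inl h5⟩
            · rintro ⟨p, h1, h2, h3, h4, h5 | ⟨rfl, rfl⟩⟩
              · exact ⟨p, h1, h2, h3, h4, h5⟩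
              · exact absurd ⟨hC.2 h4, h2.symm, rfl⟩ hif
        have hrun : ∀ (p p' : Cmd) (b b' : Test), (Cmd.seq (.cond b p .skip) (.cond b' p' .skip)).run
            m' = (Cmd.cond b' p' .skip).run ((Cmd.cond b p .skip).run m') := fun _ _ _ _ => rfl
        intro r i
        refine ⟨key (fun a b => (a, b) ∈ E) ((q, j) ∈ E) (m'.arr 9) _ (fun r i => ?_) Iff.rfl
          (fun r i => (h r i).1) r i, key (fun a b => (b, a) ∈ E) ((j, q) ∈ E) (m'.arr 10) _
          (fun r i => ?_) Iff.rfl (fun r i => (h r i).2) r i⟩ <;>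
        · rw [hrun]
          by_cases h1 : (q, j) ∈ E <;> by_cases h2 : (j, q) ∈ E <;>
          simp [Cmd.run, Expr.eval, Expr.cell, hq, hj, hm'.row, hE'.pos_iff, h8', h1, h2, cell_inj]
      · simp only [Test.Holds, Test.pos_holds, Expr.eval, hq, hj, hm'.pos_indicator,
          ← mem_targets] at hc
        intro r i
        rw [Cmd.run, (h r i).1, (h r i).2]
        constructor <;>
        · refine exists_congr fun p => and_congr_right fun hp => and_congr_right fun _ =>
            and_congr_right fun hi => and_congr_right fun _ => ?_
          rw [cell_lt_succ]
          refine ⟨.inl, fun h => h.resolve_right ?_⟩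
          rintro ⟨rfl, rfl⟩
          exact hc ⟨hp, hi⟩
    · intro m' h r hr hrr i
      rw [(h r i).1, (h r i).2]
      simp only [cell_lt, and_true, Input.bip, Finset.mem_filter, Finset.mem_product,
        hρ.mem_component hr hrr]
      constructor
      · rintro ⟨⟨q, h1, h2, h3, h4⟩, q', h1', h2', -, h4'⟩
        exact ⟨⟨mem_sccs.2 ⟨r, hr, rfl⟩, h3⟩, q, ⟨h1, h2⟩, q', ⟨h1', h2'⟩, h4, h4'⟩
      · rintro ⟨⟨-, hi⟩, q, ⟨h1, h2⟩, q', ⟨h1', h2'⟩, h3, h3'⟩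
        exact ⟨⟨q, h1, h2, hi, h3⟩, q', h1', h2', hi, h3'⟩

/-! ### The auction -/

/-- The state of the auction: vertex `i` is owned by `r` if `own i = r + 1`, and its level is
`d i`. All members of `S`, except for the bidder `cur - 1`, have been served, or see only vertices
of level `l`, in which case `flag` is set. -/
structure Auction (adj : Fin n → Fin n → Prop) (l : ℕ) (S : Fin n → Prop) (own d : ℕ → ℕ)
    (cur flag : ℕ) : Prop where
  level_le : ∀ i : Fin n, d i ≤ l
  owner : ∀ i : Fin n, own i = 0 ∧ d i = 0 ∨ ∃ r : Fin n, S r ∧ (r : ℕ) + 1 ≠ cur ∧ own i = r + 1 ∧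
    adj r i ∧ ∀ j, adj r j → d i ≤ d j + 1
  inj : ∀ i j : Fin n, own i = own j → own i ≠ 0 → i = j
  bidder : cur = 0 ∨ ∃ r : Fin n, S r ∧ cur = r + 1
  high : ∀ r : Fin n, S r → (r : ℕ) + 1 ≠ cur → (∀ i : Fin n, own i ≠ r + 1) →
    flag ≠ 0 ∧ ∀ j, adj r j → l ≤ d j
  flagged : flag ≠ 0 → ∃ r : Fin n, S r ∧ (r : ℕ) + 1 ≠ cur ∧ ∀ i : Fin n, own i ≠ r + 1

section Auction

variable {adj : Fin n → Fin n → Prop} {l : ℕ} {S S' : Fin n → Prop} {own d : ℕ → ℕ}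
  {c flag : ℕ}

theorem Auction.init (hS : ∀ r, ¬ S r) (hown : ∀ i : Fin n, own i = 0) (hd : ∀ i : Fin n, d i = 0) :
    Auction adj l S own d 0 0 :=
  ⟨fun i => by simp [hd], fun i => .inl ⟨hown i, hd i⟩, fun i j _ h => absurd (hown i) h, .inl rfl,
    fun r hr => absurd hr (hS r), fun h => absurd rfl h⟩

theorem Auction.congr (h : Auction adj l S own d c flag) (hS : ∀ r, S' r ↔ S r) :
    Auction adj l S' own d c flag := by
  obtain rfl : S' = S := funext fun r => propext (hS r)
  exact h

/-- A new bidder enters. -/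
theorem Auction.start (h : Auction adj l S own d 0 flag) {r : Fin n} (hr : ¬ S r)
    (hS : ∀ q, S' q ↔ S q ∨ q = r) : Auction adj l S' own d (r + 1) flag := by
  have hne : ∀ q, S q → (q : ℕ) + 1 ≠ r + 1 := by
    intro q hq hqr
    obtain rfl : q = r := Fin.ext (by omega)
    exact hr hq
  refine ⟨h.level_le, fun i => ?_, h.inj, .inr ⟨r, (hS r).2 (.inr rfl), rfl⟩, fun q hq hqr hfree => ?_,
    fun hf => ?_⟩
  · obtain h0 | ⟨q, hq, -, h1⟩ := h.owner i
    · exact .inl h0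
    · exact .inr ⟨q, (hS q).2 (.inl hq), hne q hq, h1⟩
  · obtain hq | rfl := (hS q).1 hq
    · exact h.high q hq (by omega) hfree
    · exact absurd rfl hqr
  · obtain ⟨q, hq, -, h1⟩ := h.flagged hf
    exact ⟨q, (hS q).2 (.inl hq), hne q hq, h1⟩

/-- The bidder takes over a vertex of least level; its former owner becomes the bidder. -/
theorem Auction.swap {r i : Fin n} (h : Auction adj l S own d (r + 1) flag) (hri : adj r i)
    (hlt : d i < l) (hmin : ∀ j, adj r j → d i ≤ d j) {own' d' : ℕ → ℕ}
    (hown : ∀ j : Fin n, own' j = if j = i then (r : ℕ) + 1 else own j)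
    (hd : ∀ j : Fin n, d' j = if j = i then d i + 1 else d j) :
    Auction adj l S own' d' (own i) flag := by
  have hdd : ∀ j : Fin n, d j ≤ d' j := by
    intro j
    rw [hd]
    split_ifs with hj
    · rw [hj]
      omega
    · exact le_rfl
  have hr : S r := by
    obtain h0 | ⟨q, hq, hqr⟩ := h.bidder
    · omega
    · obtain rfl : q = r := Fin.ext (by omega)
      exact hq
  -- The bidder owns nothing, so giving it `i` keeps ownership injective.
  have hnot : ∀ j : Fin n, own j ≠ r + 1 := by
    intro j hj
    obtain ⟨h0, -⟩ | ⟨q, -, h1, h2, -⟩ := h.owner j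
    · omega
    · omega
  refine ⟨fun j => ?_, fun j => ?_, fun a b hab ha => ?_, ?_, fun q hq hqc hfree => ?_, fun hf => ?_⟩
  · rw [hd]
    split_ifs
    · omega
    · exact h.level_le j
  · rw [hown, hd]
    split_ifs with hj
    -- Here the slack of one is used: `i` had least level among the neighbours of `r` before its
    -- level was raised by one.
    · refine .inr ⟨r, hr, fun hc => hnot i hc.symm, rfl, hj ▸ hri, fun k hk => ?_⟩
      have := hmin k hk
      have := hdd k
      omega
    · obtain h0 | ⟨q, hq, h1, h2, h3, h4⟩ := h.owner j
      · exact .inl h0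
      · refine .inr ⟨q, hq, fun hc => hj (h.inj j i (h2.trans hc) (by omega)), h2, h3,
          fun k hk => (h4 k hk).trans ?_⟩
        have := hdd k
        omega
  · rw [hown, hown] at hab
    rw [hown] at ha
    split_ifs at hab ha with h1 h2 h2
    · rw [h1, h2]
    · exact absurd hab.symm (hnot b)
    · exact absurd hab (hnot a)
    · exact h.inj a b hab ha
  · obtain ⟨h0, -⟩ | ⟨q, hq, -, h2, -⟩ := h.owner i
    · exact .inl h0
    · exact .inr ⟨q, hq, h2⟩
  · have hqr : (q : ℕ) + 1 ≠ r + 1 := by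
      have := hfree i
      rw [hown, if_pos rfl] at this
      exact this.symm
    obtain ⟨h1, h2⟩ := h.high q hq hqr fun j hj => by
      by_cases hji : j = i
      · exact hqc (by rw [← hj, hji])
      · have := hfree j
        rw [hown, if_neg hji] at this
        exact this hj
    exact ⟨h1, fun j hj => (h2 j hj).trans (hdd j)⟩
  -- A member that has left stays free: neither the new owner nor the evicted one can be it.
  · obtain ⟨q, hq, h1, h2⟩ := h.flagged hf
    refine ⟨q, hq, (h2 i).symm, fun j => ?_⟩
    rw [hown]
    split_ifs
    · exact h1.symm
    · exact h2 j

/-- The bidder leaves. -/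
theorem Auction.leave {r : Fin n} (h : Auction adj l S own d (r + 1) flag)
    (hhigh : ∀ j, adj r j → l ≤ d j) : Auction adj l S own d 0 1 := by
  have hr : S r := by
    obtain h0 | ⟨q, hq, hqr⟩ := h.bidder
    · omega
    · obtain rfl : q = r := Fin.ext (by omega)
      exact hq
  refine ⟨h.level_le, fun i => ?_, h.inj, .inl rfl, fun q hq _ hfree => ⟨one_ne_zero, ?_⟩,
    fun _ => ⟨r, hr, by omega, fun i hi => ?_⟩⟩
  · obtain h0 | ⟨q, hq, -, h1⟩ := h.owner i
    · exact .inl h0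
    · exact .inr ⟨q, hq, by omega, h1⟩
  · by_cases hqr : q = r
    · exact hqr ▸ hhigh
    · exact (h.high q hq (fun hc => hqr (Fin.ext (by omega))) hfree).2
  · obtain ⟨h0, -⟩ | ⟨q, -, h1, h2, -⟩ := h.owner i
    · omega
    · omega

open Classical in
/-- The matching given by the owners. -/
noncomputable def ownMatching (P : Input (Fin n)) (E : Finset (Fin n × Fin n)) (own : ℕ → ℕ) :
    Finset (Finset (Fin n) × Fin n) :=
  Finset.univ.filter fun x => ∃ r : Fin n, own x.2 = r + 1 ∧ x.1 = component E P.targets r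

theorem mem_ownMatching {x : Finset (Fin n) × Fin n} : x ∈ ownMatching P E own ↔
    ∃ r : Fin n, own x.2 = r + 1 ∧ x.1 = component E P.targets r := by
  simp [ownMatching]

/-- With no bidder left, the auction invariant supplies the hypotheses of
`isMaximumMatching_of_levels`; the bound `|V'| + 1` exceeds the number of components. The flag is
set exactly when some component stayed free, so it decides the loop condition. -/
theorem Auction.isMaximumMatching {ρ : Fin n → Fin n} (hρ : IsSelector P E ρ)
    (hadj : ∀ r ∈ P.targets, ρ r = r → ∀ i, adj r i ↔ (component E P.targets r, i) ∈ P.bip E)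
    (h : Auction adj (P.targets.card + 1) (fun r => r ∈ P.targets ∧ ρ r = r) own d 0 flag) :
    IsMaximumMatching (P.bip E) (ownMatching P E own) ∧
    (flag = 0 ↔ (ownMatching P E own).card = (sccs E P.targets).card) := by
  have hinj : ∀ q r : Fin n, q ∈ P.targets → ρ q = q → r ∈ P.targets → ρ r = r →
      component E P.targets q = component E P.targets r → q = r := by
    intro q r hq hqq hr hrr hqr
    rw [← hqq, hρ.eq q hq r hr hqr, hrr]
  have hown : ∀ {i r : Fin n}, own i = r + 1 → (r ∈ P.targets ∧ ρ r = r) ∧ adj r i ∧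
      ∀ j, adj r j → d i ≤ d j + 1 := by
    intro i r hi
    obtain ⟨h0, -⟩ | ⟨q, hq, -, h2, h3, h4⟩ := h.owner i
    · omega
    · obtain rfl : q = r := Fin.ext (by omega)
      exact ⟨hq, h3, h4⟩
  have hM : IsMatching (P.bip E) (ownMatching P E own) := by
    refine ⟨?_, ?_⟩
    · rintro ⟨Q, i⟩ hx
      obtain ⟨r, h1, rfl⟩ := mem_ownMatching.1 hx
      obtain ⟨hr, h2, -⟩ := hown h1
      exact (hadj r hr.1 hr.2 i).1 h2
    · rintro ⟨Q, i⟩ hx ⟨Q', j⟩ hy hxy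
      obtain ⟨r, h1, rfl⟩ := mem_ownMatching.1 hx
      obtain ⟨q, h2, rfl⟩ := mem_ownMatching.1 hy
      simp only at h1 h2
      obtain ⟨hr, -⟩ := hown h1
      obtain ⟨hq, -⟩ := hown h2
      refine ⟨fun hc => ?_, fun hc => ?_⟩
      · obtain rfl := hinj r q hr.1 hr.2 hq.1 hq.2 hc
        obtain rfl := h.inj i j (h1.trans h2.symm) (by omega)
        exact hxy rfl
      · simp only at hc
        subst hc
        obtain rfl : r = q := Fin.ext (by omega)
        exact hxy rfl
  have hfree : ∀ r ∈ P.targets, ρ r = r →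
      ((∀ i, (component E P.targets r, i) ∉ ownMatching P E own) ↔ ∀ i : Fin n, own i ≠ r + 1) := by
    intro r hr hrr
    refine forall_congr' fun i => not_congr ?_
    rw [mem_ownMatching]
    constructor
    · rintro ⟨q, h1, h2⟩
      obtain ⟨hq, -⟩ := hown h1
      rw [h1, hinj r q hr hrr hq.1 hq.2 h2]
    · exact fun hi => ⟨r, hi, rfl⟩
  have hrep : ∀ Q ∈ sccs E P.targets, ∃ r ∈ P.targets, ρ r = r ∧ Q = component E P.targets r := by
    intro Q hQ
    obtain ⟨q, hq, rfl⟩ := mem_sccs.1 hQ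
    exact ⟨ρ q, hρ.mem q hq, hρ.idem hq, (hρ.component q hq).symm⟩
  have hcard : (sccs E P.targets).card < P.targets.card + 1 := by
    have : sccs E P.targets ⊆ P.targets.image (component E P.targets) := by
      intro Q hQ
      obtain ⟨q, hq, rfl⟩ := mem_sccs.1 hQ
      exact Finset.mem_image_of_mem _ hq
    exact Nat.lt_succ_of_le ((Finset.card_le_card this).trans Finset.card_image_le)
  refine ⟨isMaximumMatching_of_levels (sccs E P.targets) (fun _ => P.fst_mem_sccs) hM
    (fun i => d i) hcard ?_ ?_ ?_, ?_, ?_⟩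
  · intro i hi
    obtain h0 | ⟨r, -, -, h2, -⟩ := h.owner i
    · exact h0.2
    · exact absurd (mem_ownMatching.2 ⟨r, h2, rfl⟩) (hi _)
  · intro Q i j hi hj
    obtain ⟨r, h1, rfl⟩ := mem_ownMatching.1 hi
    obtain ⟨hr, -, h3⟩ := hown h1
    exact h3 j ((hadj r hr.1 hr.2 j).2 hj)
  · intro Q hQ hQf i hi
    obtain ⟨r, hr, hrr, rfl⟩ := hrep Q hQ
    exact (h.high r ⟨hr, hrr⟩ (by omega) ((hfree r hr hrr).1 hQf)).2 i ((hadj r hr hrr i).2 hi)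
  · rintro rfl
    refine (Input.card_matching_le hM).antisymm ?_
    have : sccs E P.targets ⊆ (ownMatching P E own).image Prod.fst := by
      intro Q hQ
      obtain ⟨r, hr, hrr, rfl⟩ := hrep Q hQ
      by_contra hc
      have hc' : ∀ i, (component E P.targets r, i) ∉ ownMatching P E own := fun i hi =>
        hc (Finset.mem_image.2 ⟨_, hi, rfl⟩)
      exact (h.high r ⟨hr, hrr⟩ (by omega) ((hfree r hr hrr).1 hc')).1 rfl
    exact (Finset.card_le_card this).trans Finset.card_image_le
  · intro hc
    by_contra hf
    obtain ⟨r, ⟨hr, hrr⟩, -, h2⟩ := h.flagged hf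
    obtain ⟨i, hi⟩ := hM.exists_mem_of_card (fun _ => P.fst_mem_sccs) hc
      (mem_sccs.2 ⟨r, hr, rfl⟩)
    exact (hfree r hr hrr).2 h2 i hi

end Auction

/-! ### The matching program -/

/-- The index, in an adjacency matrix, of the bidder in register `7` and the vertex in
register `5`. -/
def Expr.bidderCell : Expr := .add (.get 6 (.sub (.reg 7) (.lit 1))) (.reg 5)

/-- Find a neighbour of least level of the bidder, if there is one of level below the bound. -/
def scan : Cmd :=
  .seq (.set 8 (.lit 0)) <| .seq (.set 9 (.reg 3)) <| Cmd.forN 5 <|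
    .cond (.both (.both (.pos (.get 9 .bidderCell)) (.pos (.get 10 .bidderCell)))
      (.le (.add (.get 12 (.reg 5)) (.lit 1)) (.reg 9)))
    (.seq (.set 8 (.add (.reg 5) (.lit 1))) (.set 9 (.get 12 (.reg 5)))) .skip

/-- A running minimum, started at the bound `|V'| + 1` in register `9`. Only strictly smaller levels
are accepted, so register `8` stays `0` if all neighbours have reached the bound. -/
theorem runs_scan (hm : Setup P m) {r : Fin n} (hr : m.reg 7 = r + 1) {adj : Fin n → Prop}
    (hadj : ∀ i : Fin n, (1 ≤ m.arr 9 (r * n + i) ∧ 1 ≤ m.arr 10 (r * n + i)) ↔ adj i) :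
    Runs scan m (80 * n) fun m' =>
      (m'.reg 8 = 0 ∧ ∀ i, adj i → P.targets.card + 1 ≤ m.arr 12 i) ∨
      ∃ i : Fin n, m'.reg 8 = i + 1 ∧ m'.reg 9 = m.arr 12 i ∧ adj i ∧
        m.arr 12 i < P.targets.card + 1 ∧ ∀ j, adj j → m.arr 12 i ≤ m.arr 12 j := by
  have hn := hm.one_le
  refine (Runs.seq (B := 2) (B' := 72 * n) (Runs.set fun hf₁ => ?_)).le (by omega)
  refine (Runs.seq (B := 2) (B' := 70 * n) (Runs.set fun hf₂ => ?_)).le (by omega)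
  have hm₁ := hm.frame hf₁
  have hm₂ := hm₁.frame hf₂
  refine (Runs.forN (n := n) (B := 50) (fun k m' =>
    (m'.reg 8 = 0 ∧ m'.reg 9 = P.targets.card + 1 ∧
      ∀ i : Fin n, (i : ℕ) < k → adj i → P.targets.card + 1 ≤ m.arr 12 i) ∨
    ∃ i : Fin n, m'.reg 8 = i + 1 ∧ m'.reg 9 = m.arr 12 i ∧ adj i ∧
      m.arr 12 i < P.targets.card + 1 ∧
      ∀ j : Fin n, (j : ℕ) < k → adj j → m.arr 12 i ≤ m.arr 12 j)
    hm₂.size hn (by decide) rfl rfl ?_ ?_ ?_).mono le_rfl ?_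
  · intro k m' v h
    simpa using h
  · left
    simp [Expr.eval, hm.bound]
  · intro i m₃ hf₃ hi h
    have hm₃ := hm₂.frame hf₃
    have h7 : m₃.reg 7 = r + 1 := by rw [hf₃.reg 7 rfl, hf₂.reg 7 rfl, hf₁.reg 7 rfl, hr]
    have h9 : m₃.arr 9 = m.arr 9 := by rw [hf₃.arr 9 rfl, hf₂.arr 9 rfl, hf₁.arr 9 rfl]
    have h10 : m₃.arr 10 = m.arr 10 := by rw [hf₃.arr 10 rfl, hf₂.arr 10 rfl, hf₁.arr 10 rfl]
    have h12 : m₃.arr 12 = m.arr 12 := by rw [hf₃.arr 12 rfl, hf₂.arr 12 rfl, hf₁.arr 12 rfl]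
    refine Runs.branch rfl (fun hc => ?_) (fun hc => ?_)
    · simp only [Test.Holds, Test.pos_holds, Expr.eval, Expr.bidderCell, h7, hi,
        Nat.add_sub_cancel, hm₃.row, h9, h10, h12, hadj] at hc
      right
      refine ⟨i, by simp [Cmd.run, Expr.eval, hi], by simp [Cmd.run, Expr.eval, hi, h12], hc.1, ?_,
        fun j hj haj => ?_⟩
      · obtain ⟨-, h2, -⟩ | ⟨j, -, h2, -, h3, -⟩ := h <;> omega
      · by_cases hji : j = i
        · rw [hji]
        · have hji' : (j : ℕ) < i := by
            have := fun hc => hji (Fin.ext hc)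
            omega
          obtain ⟨-, h2, h3⟩ | ⟨k, -, h2, -, h3, h4⟩ := h
          · have := h3 j hji' haj
            omega
          · have := h4 j hji' haj
            omega
    · simp only [Test.Holds, Test.pos_holds, Expr.eval, Expr.bidderCell, h7, hi,
        Nat.add_sub_cancel, hm₃.row, h9, h10, h12, hadj] at hc
      obtain ⟨h1, h2, h3⟩ | ⟨k, h1, h2, h3, h4, h5⟩ := h
      · refine .inl ⟨h1, h2, fun j hj haj => ?_⟩
        by_cases hji : j = i
        · subst hji
          have : ¬ _ := fun hlt => hc ⟨haj, hlt⟩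
          omega
        · have := fun hc => hji (Fin.ext hc)
          exact h3 j (by omega) haj
      · refine .inr ⟨k, h1, h2, h3, h4, fun j hj haj => ?_⟩
        by_cases hji : j = i
        · subst hji
          have : ¬ _ := fun hlt => hc ⟨haj, hlt⟩
          omega
        · have := fun hc => hji (Fin.ext hc)
          exact h5 j (by omega) haj
  · rintro m' (⟨h1, -, h3⟩ | ⟨i, h1, h2, h3, h4, h5⟩)
    · exact .inl ⟨h1, fun i => h3 i i.2⟩
    · exact .inr ⟨i, h1, h2, h3, h4, fun j => h5 j j.2⟩

/-- Let the bidder take over the vertex that `scan` has found, or leave. -/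
def bid : Cmd :=
  .seq scan <|
    .cond (.pos (.reg 8))
      (.seq (.set 13 (.get 11 (.sub (.reg 8) (.lit 1)))) <|
        .seq (.put 11 (.sub (.reg 8) (.lit 1)) (.reg 7)) <|
        .seq (.put 12 (.sub (.reg 8) (.lit 1)) (.add (.reg 9) (.lit 1))) (.set 7 (.reg 13)))
      (.seq (.set 7 (.lit 0)) (.set 10 (.lit 1)))

/-- Decreases with every bid. -/
def auctionVariant (n l : ℕ) (m : Memory) : ℕ :=
  ∑ i : Fin n, (l - m.arr 12 i) + if m.reg 7 = 0 then 0 else 1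

theorem auctionVariant_le (n l : ℕ) (m : Memory) : auctionVariant n l m ≤ n * l + 1 := by
  refine Nat.add_le_add ?_ (by split_ifs <;> simp)
  refine (Finset.sum_le_card_nsmul _ _ l fun i _ => Nat.sub_le _ _).trans ?_
  simp

/-- The memory holds a state of the auction. -/
def HoldsAuction (P : Input (Fin n)) (E : Finset (Fin n × Fin n)) (S : Fin n → Prop)
    (m : Memory) : Prop :=
  Auction (fun r i => (component E P.targets r, i) ∈ P.bip E) (P.targets.card + 1) S
    (m.arr 11) (m.arr 12) (m.reg 7) (m.reg 10)

/-- A takeover raises one level that was below the bound, so the sum in the variant drops. When the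
bidder leaves, the sum is unchanged and the last summand drops from `1` to `0`. -/
theorem runs_bid (hm : Setup P m) {ρ : Fin n → Fin n} (hadj : HoldsAdjacency P E ρ m)
    {S : Fin n → Prop} (hS : ∀ r, S r → r ∈ P.targets ∧ ρ r = r) (h : HoldsAuction P E S m)
    (hpos : 1 ≤ m.reg 7) :
    Runs bid m (130 * n) fun m' => HoldsAuction P E S m' ∧
      auctionVariant n (P.targets.card + 1) m' < auctionVariant n (P.targets.card + 1) m := by
  have hn := hm.one_le
  obtain h0 | ⟨r, hr, h7⟩ := h.bidder
  · omega
  obtain ⟨hrt, hrr⟩ := hS r hr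
  refine (Runs.seq (B := 80 * n) (B' := 50) ?_).le (by omega)
  refine (runs_scan hm h7 (hadj r hrt hrr)).mono le_rfl fun m₁ h₁ hf => ?_
  have hA : HoldsAuction P E S m₁ := by
    have := h
    rw [HoldsAuction, ← hf.arr 11 rfl, ← hf.arr 12 rfl, ← hf.reg 7 rfl, ← hf.reg 10 rfl] at this
    exact this
  have h7' : m₁.reg 7 = r + 1 := (hf.reg 7 rfl).trans h7
  have h12 : m₁.arr 12 = m.arr 12 := hf.arr 12 rfl
  have hv : auctionVariant n (P.targets.card + 1) m =
      auctionVariant n (P.targets.card + 1) m₁ := by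
    simp only [auctionVariant, h12, hf.reg 7 rfl]
  rw [hv]
  rw [← h12] at h₁
  unfold HoldsAuction at hA ⊢
  rw [h7'] at hA
  refine Runs.branch rfl (fun hc => ?_) (fun hc => ?_)
  · simp only [Test.pos_holds, Expr.eval] at hc
    obtain ⟨h0, -⟩ | ⟨i, h8, h9, h1, h2, h3⟩ := h₁
    · omega
    · generalize hm₂ : Cmd.run _ m₁ = m₂
      have e7 : m₂.reg 7 = m₁.arr 11 i := by
        simp [← hm₂, Cmd.run, Expr.eval, h8]
      have e10 : m₂.reg 10 = m₁.reg 10 := by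
        simp [← hm₂, Cmd.run]
      have e11 : ∀ j : Fin n, m₂.arr 11 j = if j = i then (r : ℕ) + 1 else m₁.arr 11 j := fun j => by
        simp [← hm₂, Cmd.run, Expr.eval, h8, h7', Fin.ext_iff]
      have e12 : ∀ j : Fin n, m₂.arr 12 j = if j = i then m₁.arr 12 i + 1 else m₁.arr 12 j :=
        fun j => by simp [← hm₂, Cmd.run, Expr.eval, h8, h9, h12, Fin.ext_iff]
      constructor
      · rw [e7, e10]
        exact hA.swap h1 h2 h3 e11 e12
      · rw [auctionVariant, auctionVariant, if_neg (by omega : ¬ m₁.reg 7 = 0)]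
        refine Nat.add_lt_add_of_lt_of_le (Finset.sum_lt_sum (fun j _ => ?_) ⟨i, Finset.mem_univ i, ?_⟩)
          (by split_ifs <;> simp)
        · rw [e12]
          split_ifs with hji
          · rw [hji]
            omega
          · exact le_rfl
        · rw [e12, if_pos rfl]
          omega
  · simp only [Test.pos_holds, Expr.eval] at hc
    obtain ⟨-, h1⟩ | ⟨i, h8, -⟩ := h₁
    · constructor
      · simpa [Cmd.run, Expr.eval] using hA.leave h1
      · simp [auctionVariant, Cmd.run, Expr.eval, h7']
    · omega

/-- Compute a maximum matching by an auction: register `10` is set if some component is left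
over. -/
def auction : Cmd :=
  .seq (Cmd.forN 4 (.seq (.put 11 (.reg 4) (.lit 0)) (.put 12 (.reg 4) (.lit 0)))) <|
    .seq (.seq (.set 10 (.lit 0)) (.set 7 (.lit 0))) <|
    Cmd.forT 6 <| .cond (.eq (.get 8 (.reg 6)) (.reg 6))
      (.seq (.set 7 (.add (.reg 6) (.lit 1))) (.loop (.pos (.reg 7)) bid)) .skip

theorem HoldsAdjacency.frame {ρ : Fin n → Fin n} {p : Cmd} (h : HoldsAdjacency P E ρ m)
    (hf : p.Frame m m') (h9 : p.writesArr 9 = false := by rfl)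
    (h10 : p.writesArr 10 = false := by rfl) : HoldsAdjacency P E ρ m' := by
  unfold HoldsAdjacency at h ⊢
  rw [hf.arr 9 h9, hf.arr 10 h10]
  exact h

/-- Each representative starts a chain of at most `n * (|V'| + 1) + 1` bids, and each bid takes time
`O(n)`. Over all targets this is `O((|V'| * n) ^ 2)`. -/
theorem runs_auction (hm : Setup P m) {ρ : Fin n → Fin n} (hadj : HoldsAdjacency P E ρ m)
    (h8 : ∀ q ∈ P.targets, m.arr 8 q = ρ q) :
    Runs auction m (1000 * (P.targets.card * n) ^ 2) fun m' => m'.reg 7 = 0 ∧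
      HoldsAuction P E (fun r => r ∈ P.targets ∧ ρ r = r) m' := by
  have hn := hm.one_le
  have ht : 1 ≤ P.targets.card := P.targets_nonempty.card_pos
  refine (Runs.seq (B := 70 * n) (B' := 4 + (P.targets.card * (20 +
    ((n * (P.targets.card + 1) + 2) * (130 * n + 4))) + 26 * n)) ?_).le ?_
  swap
  · nlinarith [Nat.mul_le_mul ht hn, Nat.mul_le_mul_right (P.targets.card * n) (Nat.mul_le_mul ht hn),
      Nat.mul_le_mul_right n ht, Nat.mul_le_mul_left P.targets.card hn]
  refine (Runs.forN (n := n) (B := 50) (fun k m' => ∀ i : Fin n, (i : ℕ) < k →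
    m'.arr 11 i = 0 ∧ m'.arr 12 i = 0) hm.size hn (by decide) rfl rfl ?_ ?_ ?_).mono le_rfl ?_
  · intro k m' v h
    exact h
  · intro i hi
    omega
  · intro i m' hf hi h
    refine Runs.straight rfl fun j hj => ?_
    simp only [Cmd.run, Expr.eval, Memory.setArr_apply, Memory.setArr_reg, hi]
    by_cases hji : (j : ℕ) = i
    · simp [hji]
    · simp [hji, h j (by omega)]
  · intro m₁ h₁ hf₁
    have hm₁ := hm.frame hf₁
    refine Runs.seq (Runs.straight rfl fun hf₂ => ?_)
    generalize hm₂' : Cmd.run _ m₁ = m₂ at hf₂ ⊢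
    have hm₂ := hm₁.frame hf₂
    have e7 : m₂.reg 7 = 0 := by simp [← hm₂', Cmd.run, Expr.eval]
    have e10 : m₂.reg 10 = 0 := by simp [← hm₂', Cmd.run, Expr.eval]
    refine (Runs.forT P (fun k m' => m'.reg 7 = 0 ∧
      HoldsAuction P E (fun r => (r ∈ P.targets ∧ ρ r = r) ∧ (r : ℕ) < k) m')
      hm₂.size hn hm₂.indicator (by decide) rfl rfl rfl ?_ ?_ ?_ ?_).mono le_rfl ?_
    · intro k m' v h
      simpa [HoldsAuction] using h
    · refine ⟨e7, ?_⟩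
      rw [HoldsAuction, e7, e10, hf₂.arr 11 rfl, hf₂.arr 12 rfl]
      exact Auction.init (by simp) (fun i => (h₁ i i.2).1) fun i => (h₁ i i.2).2
    -- A vertex of `I` is not a representative, so the set of entered bidders does not change.
    · rintro i m' - hi ⟨h7, h⟩
      refine ⟨h7, h.congr fun r => ?_⟩
      have : r ∈ P.targets → ¬ (r : ℕ) = i := fun hr hri => hi (Fin.ext hri ▸ hr)
      constructor
      · rintro ⟨hr, hlt⟩
        have := this hr.1
        exact ⟨hr, by omega⟩
      · exact fun hr => ⟨hr.1, by omega⟩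
    · rintro r m₃ hf₃ hr hrt ⟨h7, h⟩
      have hm₃ := hm₂.frame hf₃
      have hadj₃ := ((hadj.frame hf₁).frame hf₂).frame hf₃
      have h8₃ : m₃.arr 8 r = ρ r := by
        rw [hf₃.arr 8 rfl, hf₂.arr 8 rfl, hf₁.arr 8 rfl, h8 r hrt]
      have hcond : (Test.eq (.get 8 (.reg 6)) (.reg 6)).Holds m₃ ↔ ρ r = r := by
        rw [Test.eq_holds]
        simp [Expr.eval, hr, h8₃, Fin.ext_iff]
      refine (Runs.cond (B := 4 + (n * (P.targets.card + 1) + 2) * (130 * n + 4))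
        (fun hc => ?_) (fun hc => ?_)).le (by simp only [Test.time, Test.eq, Expr.time]; omega)
      · have hrr := hcond.1 hc
        refine Runs.seq (Runs.straight rfl fun hf₄ => ?_)
        generalize hm₄' : Cmd.run _ m₃ = m₄ at hf₄ ⊢
        have hm₄ := hm₃.frame hf₄
        have hadj₄ := hadj₃.frame hf₄
        have e7 : m₄.reg 7 = r + 1 := by simp [← hm₄', Cmd.run, Expr.eval, hr]
        have hA : HoldsAuction P E (fun q => (q ∈ P.targets ∧ ρ q = q) ∧ (q : ℕ) < r + 1) m₄ := by
          rw [HoldsAuction, e7, hf₄.arr 11 rfl, hf₄.arr 12 rfl, hf₄.reg 10 rfl]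
          rw [HoldsAuction, h7] at h
          refine h.start (by simp) fun q => ?_
          rw [Nat.lt_succ_iff, le_iff_lt_or_eq, ← Fin.ext_iff]
          constructor
          · rintro ⟨h1, h2 | h2⟩
            · exact .inl ⟨h1, h2⟩
            · exact .inr h2
          · rintro (⟨h1, h2⟩ | rfl)
            · exact ⟨h1, .inl h2⟩
            · exact ⟨⟨hrt, hrr⟩, .inr rfl⟩
        refine (Runs.loop (B := 130 * n) (fun k m' =>
          HoldsAuction P E (fun q => (q ∈ P.targets ∧ ρ q = q) ∧ (q : ℕ) < r + 1) m' ∧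
          auctionVariant n (P.targets.card + 1) m' = k) ?_ ⟨hA, rfl⟩).mono ?_ ?_
        · rintro k m₅ hf₅ hpos ⟨hA₅, rfl⟩
          refine (runs_bid (hm₄.frame hf₅) (hadj₄.frame hf₅) (fun _ h => h.1) hA₅ hpos).mono le_rfl ?_
          exact fun m' h => ⟨_, h.2, h.1, rfl⟩
        · refine Nat.mul_le_mul (Nat.succ_le_succ (auctionVariant_le _ _ _)) ?_
          simp only [Test.time, Test.pos, Expr.time]
          omega
        · rintro m' ⟨⟨k, hA', -⟩, hneg⟩
          simp only [Test.pos_holds, Expr.eval] at hneg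
          exact ⟨by omega, hA'⟩
      · refine Runs.le (Runs.straight (B := 1) rfl ⟨h7, h.congr fun q => ?_⟩) (by omega)
        have : ρ q = q → ¬ (q : ℕ) = r := fun hq hqr => hc (hcond.2 (Fin.ext hqr ▸ hq))
        constructor
        · rintro ⟨hq, hlt⟩
          have := this hq.2
          exact ⟨hq, by omega⟩
        · exact fun hq => ⟨hq.1, by omega⟩
    · rintro m' ⟨h7, h⟩
      exact ⟨h7, h.congr fun r => by simp⟩

/-- Write down the matching. -/
def output : Cmd :=
  Cmd.forN₂ 4 5 <| .cond (.eq (.add (.get 8 (.reg 5)) (.lit 1)) (.get 11 (.reg 4)))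
    (.put 3 (.add (.reg 2) (.reg 5)) (.add (.reg 4) (.lit 1))) .skip

/-- Array `3` is still zero from `off` on, so unmatched targets need no write. Earlier matchings,
below `off`, are not touched. -/
theorem runs_output (hm : Setup P m) {ρ : Fin n → Fin n} (hρ : IsSelector P E ρ)
    (h8 : ∀ q ∈ P.targets, m.arr 8 q = ρ q) {off : ℕ} (hoff : m.reg 2 = off)
    (h3 : ∀ j, off ≤ j → m.arr 3 j = 0) (hown : ∀ i r : Fin n, m.arr 11 i = r + 1 →
      r ∈ P.targets ∧ ρ r = r) :
    Runs output m (90 * n ^ 2) fun m' =>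
      HoldsMatching P m' 3 off (ownMatching P E (m.arr 11)) ∧
      (∀ j < off, m'.arr 3 j = m.arr 3 j) ∧ ∀ j, off + n ≤ j → m'.arr 3 j = 0 := by
  refine (Runs.forN₂ (n := n) (B := 50) (fun k m' =>
    (∀ v ∈ P.targets, (∃ i : Fin n, m.arr 11 i = ρ v + 1 ∧ m'.arr 3 (off + v) = i + 1) ∨
      ((∀ i : Fin n, (i : ℕ) * n + v < k → m.arr 11 i ≠ ρ v + 1) ∧ m'.arr 3 (off + v) = 0)) ∧
    (∀ j < off, m'.arr 3 j = m.arr 3 j) ∧ ∀ j, off + n ≤ j → m'.arr 3 j = 0)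
    hm.size hm.one_le (by decide) (by decide) (by decide) rfl rfl rfl ?_ ?_ ?_).mono le_rfl ?_
  · intro k m' v h
    exact ⟨h, h⟩
  · exact ⟨fun v _ => .inr ⟨fun i hi => by omega, h3 _ (by omega)⟩, fun _ _ => rfl,
      fun j hj => h3 j (by omega)⟩
  · rintro i v m' hf hi hv ⟨g1, g2, g3⟩
    have e2 : m'.reg 2 = off := (hf.reg 2 rfl).trans hoff
    have e8 : m'.arr 8 = m.arr 8 := hf.arr 8 rfl
    have e11 : m'.arr 11 = m.arr 11 := hf.arr 11 rfl
    refine Runs.branch rfl (fun hc => ?_) (fun hc => ?_) <;>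
      simp only [Test.eq_holds, Expr.eval, hi, hv, e8, e11] at hc
    · simp only [Cmd.run, Expr.eval, hi, hv, e2, Memory.setArr_apply, true_and]
      refine ⟨fun w hw => ?_, fun j hj => ?_, fun j hj => ?_⟩
      · by_cases hwv : w = v
        · subst hwv
          exact .inl ⟨i, by rw [← hc, h8 w hw], if_pos rfl⟩
        · have hne : ¬ off + (w : ℕ) = off + v := fun h => hwv (Fin.ext (by omega))
          rw [if_neg hne]
          refine (g1 w hw).imp_right fun h => ⟨fun k hk => h.1 k ?_, h.2⟩
          exact ((cell_lt_succ _ _ _ _).1 hk).resolve_right fun h => hwv h.2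
      · rw [if_neg (by omega), g2 j hj]
      · rw [if_neg (by omega), g3 j hj]
    · refine ⟨fun w hw => (g1 w hw).imp_right fun h => ⟨fun k hk => ?_, h.2⟩, g2, g3⟩
      obtain hk | ⟨rfl, rfl⟩ := (cell_lt_succ _ _ _ _).1 hk
      · exact h.1 k hk
      · rw [← h8 w hw]
        exact fun h => hc h.symm
  · rintro m' ⟨g1, g2, g3⟩
    refine ⟨fun v hv => ?_, g2, g3⟩
    obtain ⟨i, h1, h2⟩ | ⟨h1, h2⟩ := g1 v hv
    · refine .inl ⟨(component E P.targets (ρ v), i), mem_ownMatching.2 ⟨ρ v, h1, rfl⟩, ?_, h2⟩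
      rw [hρ.component v hv]
      exact self_mem_component hv
    · refine .inr ⟨?_, h2⟩
      rintro ⟨Q, i⟩ hx hvQ
      obtain ⟨r, h3, rfl⟩ := mem_ownMatching.1 hx
      obtain ⟨hr, hrr⟩ := hown i r h3
      exact h1 i (cell_lt i v) (by rw [((hρ.mem_component hr hrr).1 hvQ).2]; exact h3)

/-- Compute a maximum matching, and write it down. -/
def compute : Cmd := .seq closure <| .seq selector <| .seq adjacency <| .seq auction output

/-- All five phases fit into `O((|V'| * n) ^ 2)` because `|V'| ≥ 1`. The graph in array `4` and the
log of the run survive by their frames. -/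
theorem runs_compute (hm : Setup P m) (hE : HoldsEdges m 4 E) {off : ℕ} (hoff : m.reg 2 = off)
    (h3 : ∀ j, off ≤ j → m.arr 3 j = 0) :
    Runs compute m (2000 * (P.targets.card * n) ^ 2) fun m' => ∃ M,
      IsMaximumMatching (P.bip E) M ∧ (m'.reg 10 = 0 ↔ M.card = (sccs E P.targets).card) ∧
      HoldsMatching P m' 3 off M ∧
      (∀ j < off, m'.arr 3 j = m.arr 3 j) ∧ ∀ j, off + n ≤ j → m'.arr 3 j = 0 := by
  have ht : 1 ≤ P.targets.card := P.targets_nonempty.card_pos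
  refine (Runs.seq (B := 210 * (P.targets.card * n ^ 2)) (B' := 90 * n ^ 2 + (180 * n ^ 2 +
    (1000 * (P.targets.card * n) ^ 2 + 90 * n ^ 2))) ?_).le ?_
  swap
  · rw [mul_pow]
    nlinarith [Nat.mul_le_mul_right (n ^ 2) ht, Nat.mul_le_mul_right (n ^ 2) (Nat.mul_le_mul ht ht),
      Nat.mul_le_mul_right (P.targets.card * n ^ 2) ht]
  refine (runs_closure hm hE).mono le_rfl fun m₁ hR hf₁ => ?_
  have hm₁ := hm.frame hf₁
  refine Runs.seq ((runs_selector hm₁ hR).mono le_rfl fun m₂ ⟨ρ, hρ, h8₂⟩ hf₂ => ?_)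
  have hm₂ := hm₁.frame hf₂
  refine Runs.seq ((runs_adjacency hm₂ ((hE.frame hf₁).frame hf₂) hρ h8₂).mono le_rfl
    fun m₃ hadj hf₃ => ?_)
  have hm₃ := hm₂.frame hf₃
  have h8₃ : ∀ q ∈ P.targets, m₃.arr 8 q = ρ q := by
    rw [hf₃.arr 8 rfl]
    exact h8₂
  refine Runs.seq ((runs_auction hm₃ hadj h8₃).mono le_rfl fun m₄ ⟨h7, hA⟩ hf₄ => ?_)
  have hm₄ := hm₃.frame hf₄
  have h8₄ : ∀ q ∈ P.targets, m₄.arr 8 q = ρ q := by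
    rw [hf₄.arr 8 rfl]
    exact h8₃
  have e2 : m₄.reg 2 = off := by
    rw [hf₄.reg 2 rfl, hf₃.reg 2 rfl, hf₂.reg 2 rfl, hf₁.reg 2 rfl, hoff]
  have e3 : m₄.arr 3 = m.arr 3 := by
    rw [hf₄.arr 3 rfl, hf₃.arr 3 rfl, hf₂.arr 3 rfl, hf₁.arr 3 rfl]
  rw [HoldsAuction, h7] at hA
  rw [← e3] at h3 ⊢
  refine (runs_output (E := E) hm₄ hρ h8₄ e2 h3 fun i r hi => ?_).frame.mono le_rfl
    fun m' ⟨hf, h1, h2, h3⟩ => ⟨_, ?_, ?_, h1, h2, h3⟩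
  · obtain ⟨h0, -⟩ | ⟨q, hq, -, h1, -⟩ := hA.owner i
    · omega
    · obtain rfl : q = r := Fin.ext (by omega)
      exact hq
  · exact (hA.isMaximumMatching hρ fun _ _ _ _ => Iff.rfl).1
  · rw [hf.reg 10 rfl]
    exact (hA.isMaximumMatching hρ fun _ _ _ _ => Iff.rfl).2

/-! ### The main program -/

/-- Find an edge of highest cost. -/
def findMax : Cmd :=
  .seq (.set 11 (.lit 0)) <| Cmd.forN₂ 4 5 <|
    -- Register `11` holds the row plus one, so `0` means that no edge has been found. In that case
    -- the index of the table lookup is meaningless, but its result is masked by the other conjunct.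
    .cond (.both (.pos (.get 4 (.cell 4 5))) (.neg (.both (.pos (.reg 11))
      (.neg (.tableLe (.add (.get 6 (.sub (.reg 11) (.lit 1))) (.reg 12)) (.cell 4 5))))))
    (.seq (.set 11 (.add (.reg 4) (.lit 1))) (.set 12 (.reg 5))) .skip

theorem runs_findMax (hm : Setup P m) (hE : HoldsEdges m 4 E) (hne : E.Nonempty) :
    Runs findMax m (100 * n ^ 2) fun m' => ∃ a b : Fin n, m'.reg 11 = a + 1 ∧ m'.reg 12 = b ∧
      (a, b) ∈ E ∧ ∀ f ∈ E, P.cost f ≤ P.cost (a, b) := by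
  have hn := Nat.one_le_pow 2 n hm.one_le
  refine (Runs.seq (B := 2) (B' := 90 * n ^ 2) (Runs.set fun hf₁ => ?_)).le (by omega)
  have hm₁ := hm.frame hf₁
  refine (Runs.forN₂ (n := n) (B := 50) (fun k m' =>
    (m'.reg 11 = 0 ∧ ∀ u v : Fin n, (u : ℕ) * n + v < k → (u, v) ∉ E) ∨
    ∃ a b : Fin n, m'.reg 11 = a + 1 ∧ m'.reg 12 = b ∧ (a, b) ∈ E ∧
      ∀ u v : Fin n, (u : ℕ) * n + v < k → (u, v) ∈ E → P.cost (u, v) ≤ P.cost (a, b))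
    hm₁.size hm.one_le (by decide) (by decide) (by decide) rfl rfl rfl ?_ ?_ ?_).mono le_rfl ?_
  · intro k m' v h
    constructor <;> simpa using h
  · exact .inl ⟨by simp [Expr.eval], fun u v h => by omega⟩
  · intro u v m' hf hu hv h
    have hm' := hm₁.frame hf
    have hE' := (hE.frame hf₁).frame hf
    have ht : ∀ a b : Fin n, m'.table (a * n + b) = P.cost (a, b) := fun a b => hm'.table (a, b)
    have hcell := hm'.eval_cell hu hv
    refine Runs.branch rfl (fun hc => ?_) (fun hc => ?_) <;>
      simp only [Test.Holds, Test.pos_holds, Expr.eval, hcell, hE'.pos_iff] at hc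
    · obtain ⟨huv, hc⟩ := hc
      refine .inr ⟨u, v, by simp [Cmd.run, Expr.eval, hu], by simp [Cmd.run, Expr.eval, hv], huv,
        fun x y hxy hxE => ?_⟩
      obtain hxy | ⟨rfl, rfl⟩ := (cell_lt_succ _ _ _ _).1 hxy
      · obtain ⟨-, h⟩ | ⟨a, b, ha, hb, -, h⟩ := h
        · exact absurd hxE (h x y hxy)
        · simp only [ha, hb, Nat.add_sub_cancel, hm'.row, ht] at hc
          have : P.cost (a, b) ≤ P.cost (u, v) := by
            by_contra hcon
            exact hc ⟨by omega, hcon⟩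
          exact (h x y hxy hxE).trans this
      · exact le_rfl
    · obtain ⟨h0, h⟩ | ⟨a, b, ha, hb, hab, h⟩ := h
      · refine .inl ⟨h0, fun x y hxy hxE => ?_⟩
        obtain hxy | ⟨rfl, rfl⟩ := (cell_lt_succ _ _ _ _).1 hxy
        · exact h x y hxy hxE
        · exact hc ⟨hxE, fun h => by omega⟩
      · refine .inr ⟨a, b, ha, hb, hab, fun x y hxy hxE => ?_⟩
        obtain hxy | ⟨rfl, rfl⟩ := (cell_lt_succ _ _ _ _).1 hxy
        · exact h x y hxy hxE
        · simp only [ha, hb, Nat.add_sub_cancel, hm'.row, ht] at hc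
          by_contra hcon
          exact hc ⟨hxE, fun h => h.2 (le_of_not_ge hcon)⟩
  · rintro m' (⟨-, h⟩ | ⟨a, b, ha, hb, hab, h⟩)
    · obtain ⟨⟨u, v⟩, huv⟩ := hne
      exact absurd huv (h u v (cell_lt u v))
    · exact ⟨a, b, ha, hb, hab, fun f hf => h f.1 f.2 (cell_lt _ _) hf⟩

/-- Delete the edge that `findMax` has found. -/
def delete : Cmd :=
  .seq (.put 1 (.reg 1) (.sub (.reg 11) (.lit 1))) <| .seq (.put 2 (.reg 1) (.reg 12)) <|
    .seq (.put 4 (.add (.get 6 (.sub (.reg 11) (.lit 1))) (.reg 12)) (.lit 0)) <|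
    .seq (.set 1 (.add (.reg 1) (.lit 1))) (.set 2 (.add (.reg 2) (.reg 0)))

/-- The body of the main loop. -/
def iteration : Cmd := .seq findMax <| .seq delete compute

/-- The preparations for the main loop. -/
def start : Cmd := .seq rows <| .seq fillEdges compute

/-- Write down the returned pair. -/
def finish : Cmd :=
  -- The returned graph is the final one with the last deleted edge put back.
  .seq (.put 4 (.add (.get 6 (.get 1 (.sub (.reg 1) (.lit 1)))) (.get 2 (.sub (.reg 1) (.lit 1))))
    (.lit 1)) <|
  -- The returned matching is the last but one in the log; subtracting `n` from the current offset
  -- gives its position.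
  Cmd.forN 4 (.put 5 (.reg 4) (.get 3 (.add (.sub (.reg 2) (.reg 0)) (.reg 4))))

/-- The program that carries out the algorithm. -/
def algorithm : Cmd := .seq start <| .seq (.loop (.le (.reg 10) (.lit 0)) iteration) finish

/-- Array `1` and array `2` hold the ends of the edges that were deleted in a run. -/
def HoldsDeleted (P : Input (Fin n)) (m : Memory) (T : ℕ) (σ : ℕ → AlgState (Fin n)) : Prop :=
  ∀ k < T, ∃ u v : Fin n, m.arr 1 k = u ∧ m.arr 2 k = v ∧ P.Body (u, v) (σ k) (σ (k + 1))

/-- The memory in front of iteration `T + 1` of the main loop. -/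
structure HoldsRun (P : Input (Fin n)) (m : Memory) (T : ℕ) (σ : ℕ → AlgState (Fin n)) : Prop where
  setup : Setup P m
  run : P.IsRun T σ
  count : m.reg 1 = T
  offset : m.reg 2 = T * n
  edges : HoldsEdges m 4 (σ T).G
  guard : m.reg 10 = 0 ↔ P.Guard (σ T)
  deleted : HoldsDeleted P m T σ
  matchings : ∀ k ≤ T, HoldsMatching P m 3 (k * n) (σ k).M
  fresh : ∀ j, (T + 1) * n ≤ j → m.arr 3 j = 0

theorem HoldsMatching.congr {a a' off off' : ℕ} {M : Finset (Finset (Fin n) × Fin n)}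
    (h : HoldsMatching P m a off M)
    (hm : ∀ v : Fin n, m'.arr a' (off' + v) = m.arr a (off + v)) :
    HoldsMatching P m' a' off' M := by
  intro v hv
  rw [hm]
  exact h v hv

theorem runs_start (P : Input (Fin n)) :
    Runs start (load P) (2170 * (P.targets.card * n) ^ 2) fun m' => ∃ σ, HoldsRun P m' 0 σ := by
  have hn : 1 ≤ n := by
    obtain ⟨v, -⟩ := P.targets_nonempty
    exact v.pos
  have ht : 1 ≤ P.targets.card := P.targets_nonempty.card_pos
  refine (Runs.seq (B := 80 * n) (B' := 90 * n ^ 2 + 2000 * (P.targets.card * n) ^ 2) ?_).le ?_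
  swap
  · rw [mul_pow]
    nlinarith [Nat.mul_le_mul_right (n ^ 2) (Nat.mul_le_mul ht ht)]
  refine (runs_rows P).mono le_rfl fun m₁ hm₁ hf₁ => ?_
  have h4 : ∀ j, m₁.arr 4 j = 0 := by simp [hf₁.arr 4 rfl, load]
  refine Runs.seq ((runs_fillEdges hm₁ h4).mono le_rfl fun m₂ hE₂ hf₂ => ?_)
  have hm₂ := hm₁.frame hf₂
  have e2 : m₂.reg 2 = 0 := by
    rw [hf₂.reg 2 rfl, hf₁.reg 2 rfl]
    simp [load]
  have e3 : ∀ j, m₂.arr 3 j = 0 := by simp [hf₂.arr 3 rfl, hf₁.arr 3 rfl, load]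
  refine (runs_compute hm₂ hE₂ e2 fun j _ => e3 j).frame.mono le_rfl ?_
  rintro m' ⟨hf, M, h1, h2, h3, -, h5⟩
  refine ⟨fun _ => ⟨P.edges, M, none⟩, hm₂.frame hf, ⟨⟨rfl, h1, rfl⟩, by simp⟩, ?_, ?_,
    hE₂.frame hf, h2, fun k hk => by omega, fun k hk => ?_, fun j hj => h5 j (by omega)⟩
  · rw [hf.reg 1 rfl, hf₂.reg 1 rfl, hf₁.reg 1 rfl]
    simp [load]
  · rw [hf.reg 2 rfl, e2, zero_mul]
  · obtain rfl : k = 0 := by omega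
    rwa [zero_mul]

theorem runs_iteration {T : ℕ} {σ : ℕ → AlgState (Fin n)} (h : HoldsRun P m T σ)
    (hg : P.Guard (σ T)) :
    Runs iteration m (2150 * (P.targets.card * n) ^ 2) fun m' => ∃ σ, HoldsRun P m' (T + 1) σ := by
  have hm := h.setup
  have hn := hm.one_le
  have ht : 1 ≤ P.targets.card := P.targets_nonempty.card_pos
  refine (Runs.seq (B := 100 * n ^ 2) (B' := 50 + 2000 * (P.targets.card * n) ^ 2) ?_).le ?_
  swap
  · rw [mul_pow]
    nlinarith [Nat.mul_le_mul_right (n ^ 2) (Nat.mul_le_mul ht ht), Nat.mul_le_mul hn hn]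
  refine (runs_findMax hm h.edges (h.run.nonempty hg)).mono le_rfl ?_
  rintro m₁ ⟨a, b, ha, hb, hab, hmax⟩ hf₁
  have hm₁ := hm.frame hf₁
  have e1 : m₁.reg 1 = T := (hf₁.reg 1 rfl).trans h.count
  have e2 : m₁.reg 2 = T * n := (hf₁.reg 2 rfl).trans h.offset
  refine Runs.seq (Runs.straight rfl fun hf₂ => ?_)
  generalize hm₂' : delete.run m₁ = m₂ at hf₂ ⊢
  have hm₂ := hm₁.frame hf₂
  have e1' : m₂.reg 1 = T + 1 := by simp [← hm₂', delete, Cmd.run, Expr.eval, e1]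
  have e2' : m₂.reg 2 = (T + 1) * n := by
    simp [← hm₂', delete, Cmd.run, Expr.eval, e2, hm₁.size, Nat.succ_mul]
  have d1 : ∀ k, m₂.arr 1 k = if k = T then (a : ℕ) else m.arr 1 k := fun k => by
    simp [← hm₂', delete, Cmd.run, Expr.eval, e1, ha, hf₁.arr 1 rfl]
  have d2 : ∀ k, m₂.arr 2 k = if k = T then (b : ℕ) else m.arr 2 k := fun k => by
    simp [← hm₂', delete, Cmd.run, Expr.eval, e1, hb, hf₁.arr 2 rfl]
  have hE₂ : HoldsEdges m₂ 4 ((σ T).G.erase (a, b)) := by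
    intro u v
    have := h.edges.frame hf₁ rfl u v
    by_cases huv : u = a ∧ v = b
    · simp [← hm₂', delete, Cmd.run, Expr.eval, ha, hb, hm₁.row, huv]
    · simp [← hm₂', delete, Cmd.run, Expr.eval, ha, hb, hm₁.row, cell_inj, huv, this]
  have e3 : m₂.arr 3 = m.arr 3 := by rw [hf₂.arr 3 rfl, hf₁.arr 3 rfl]
  refine (runs_compute hm₂ hE₂ e2' fun j hj => e3 ▸ h.fresh j hj).frame.mono le_rfl ?_
  rintro m' ⟨hf, M, h1, h2, h3, h4, h5⟩
  let s : AlgState (Fin n) := ⟨(σ T).G.erase (a, b), M, some ((σ T).G, (σ T).M)⟩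
  -- The run is extended by one state, whose matching is the one that the program has just computed.
  let τ : ℕ → AlgState (Fin n) := fun k => if k ≤ T then σ k else s
  have hτ : ∀ k ≤ T, τ k = σ k := fun k hk => if_pos hk
  have hτ' : τ (T + 1) = s := if_neg (by omega)
  have hbody : P.Body (a, b) (σ T) s := ⟨hab, hmax, rfl, rfl, h1⟩
  refine ⟨τ, hm₂.frame hf, ⟨?_, fun k hk => ?_⟩, (hf.reg 1 rfl).trans e1', (hf.reg 2 rfl).trans e2',
    ?_, ?_, fun k hk => ?_, fun k hk => ?_, fun j hj => h5 j ?_⟩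
  · rw [hτ 0 (by omega)]
    exact h.run.1
  · obtain hk | rfl := Nat.lt_succ_iff_lt_or_eq.1 hk
    · rw [hτ k (by omega), hτ (k + 1) (by omega)]
      exact h.run.2 k hk
    · rw [hτ k le_rfl, hτ']
      exact ⟨hg, _, hbody⟩
  · rw [hτ']
    exact hE₂.frame hf
  · rw [hτ']
    exact h2
  · rw [hf.arr 1 rfl, hf.arr 2 rfl, d1, d2]
    obtain hk | rfl := Nat.lt_succ_iff_lt_or_eq.1 hk
    · rw [hτ k (by omega), hτ (k + 1) (by omega), if_neg (by omega), if_neg (by omega)]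
      exact h.deleted k hk
    · rw [hτ k le_rfl, hτ', if_pos rfl, if_pos rfl]
      exact ⟨a, b, rfl, rfl, hbody⟩
  · obtain hk | rfl := Nat.lt_succ_iff_lt_or_eq.1 (Nat.lt_succ_of_le hk)
    · rw [hτ k (by omega)]
      refine (h.matchings k (by omega)).congr fun v => ?_
      rw [h4 _ ?_, e3]
      have : (k + 1) * n ≤ (T + 1) * n := Nat.mul_le_mul_right n hk
      rw [Nat.succ_mul] at this
      omega
    · rw [hτ']
      exact h3
  · rw [Nat.succ_mul] at hj
    exact hj

/-- The case `T = 0` cannot occur: a halted run has a result, whereas the start state has none.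
Otherwise the result is the state before the last iteration, recovered from the log. -/
theorem runs_finish {T : ℕ} {σ : ℕ → AlgState (Fin n)} (h : HoldsRun P m T σ)
    (hg : ¬ P.Guard (σ T)) : Runs finish m (90 * n) fun m' => Documents P m' T σ := by
  have hm := h.setup
  have hn := hm.one_le
  cases T with
  | zero =>
    obtain ⟨E, M, hbest, -⟩ := h.run.exists_solution hg
    rw [h.run.1.2.2] at hbest
    cases hbest
  | succ T =>
    obtain ⟨u, v, hu, hv, huv, -, hG, hbest, -⟩ := h.deleted T (by omega)
    refine (Runs.seq (B := 20) (B' := 70 * n) (Runs.straight rfl fun hf₁ => ?_)).le (by omega)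
    generalize hm₁' : Cmd.run _ m = m₁ at hf₁ ⊢
    have hm₁ := hm.frame hf₁
    have hE₁ : HoldsEdges m₁ 4 (σ T).G := by
      intro a b
      have := h.edges a b
      by_cases hab : a = u ∧ b = v
      · simp [← hm₁', Cmd.run, Expr.eval, h.count, hu, hv, hm.row, hab, huv]
      · have hab' : (a, b) ≠ (u, v) := fun hc => hab (Prod.ext_iff.1 hc)
        rw [hG] at this
        simp [← hm₁', Cmd.run, Expr.eval, h.count, hu, hv, hm.row, cell_inj, hab, hab', this]
    have e2 : m₁.reg 2 - m₁.reg 0 = T * n := by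
      rw [hf₁.reg 2 rfl, h.offset, hm₁.size, Nat.succ_mul, Nat.add_sub_cancel]
    have e3 : m₁.arr 3 = m.arr 3 := hf₁.arr 3 rfl
    refine (Runs.forN (n := n) (B := 50) (fun k m' => ∀ i : Fin n, (i : ℕ) < k →
      m'.arr 5 i = m₁.arr 3 (T * n + i)) hm₁.size hn (by decide) rfl rfl ?_ ?_ ?_).frame.mono le_rfl ?_
    · intro k m' v h
      exact h
    · intro i hi
      omega
    · intro i m₂ hf₂ hi h₂
      refine Runs.straight rfl fun j hj => ?_
      have e2' : m₂.reg 2 - m₂.reg 0 = T * n := by rw [hf₂.reg 2 rfl, hf₂.reg 0 rfl, e2]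
      simp only [Cmd.run, Expr.eval, Memory.setArr_apply, true_and, hi, e2', hf₂.arr 3 rfl]
      split_ifs with hji
      · rw [hji]
      · exact h₂ j (by omega)
    · rintro m' ⟨hf, h5⟩
      refine ⟨?_, fun k hk => ?_, fun k hk => (h.matchings k hk).congr fun v => ?_, _, _, hbest,
        hE₁.frame hf, (h.matchings T (by omega)).congr fun v => ?_⟩
      · rw [hf.reg 1 rfl, hf₁.reg 1 rfl, h.count]
      · rw [hf.arr 1 rfl, hf.arr 2 rfl, hf₁.arr 1 rfl, hf₁.arr 2 rfl]
        exact h.deleted k hk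
      · rw [hf.arr 3 rfl, e3]
      · rw [zero_add, h5 v v.2, e3]

/-- All pairs whose first vertex is a target are edges. This turns the cost `O((|V'| * n) ^ 2)` of
an iteration into a quadratic bound in the input size. -/
theorem targets_card_mul_le (P : Input (Fin n)) : P.targets.card * n ≤ P.edges.card := by
  have : P.targets ×ˢ Finset.univ ⊆ P.edges := by
    intro x hx
    rw [Finset.mem_product, mem_targets] at hx
    simp [Input.edges, hx.1]
  simpa using Finset.card_le_card this

theorem runs_algorithm (P : Input (Fin n)) : Runs algorithm (load P) (5000 * P.size ^ 3) fun m' =>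
    ∃ T σ, P.IsRun T σ ∧ ¬ P.Guard (σ T) ∧ Documents P m' T σ := by
  have hn : 1 ≤ n := by
    obtain ⟨v, -⟩ := P.targets_nonempty
    exact v.pos
  have hsize : P.size = n + P.edges.card := by simp [Input.size]
  have hs : 1 ≤ P.size := by omega
  have hsq : (P.targets.card * n) ^ 2 ≤ P.size ^ 2 :=
    Nat.pow_le_pow_left ((targets_card_mul_le P).trans (by omega)) 2
  have hs1 : P.size ^ 2 ≤ P.size ^ 3 := Nat.pow_le_pow_right hs (by omega)
  have hs2 : 1 ≤ P.size ^ 2 := Nat.one_le_pow _ _ hs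
  have hs3 : P.size ≤ P.size ^ 3 := Nat.le_self_pow (by omega) _
  refine (Runs.seq (B := 2170 * P.size ^ 3) (B' := 2160 * P.size ^ 3 + 90 * P.size ^ 3) ?_).le
    (by omega)
  refine (runs_start P).mono (by omega) fun m₁ ⟨σ₁, h₁⟩ _ => ?_
  refine Runs.seq ?_
  -- The variant is the number of edges not yet deleted. Since `n ≥ 1`, the `|E| + 1` tests of the
  -- loop condition are at most the input size.
  refine (Runs.loop (B := 2150 * P.size ^ 2) (k := P.edges.card) (fun k m' => ∃ T σ, HoldsRun P m' T σ ∧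
    T + k = P.edges.card) ?_ ⟨0, σ₁, h₁, by omega⟩).mono ?_ ?_
  · rintro k m' - hb ⟨T, σ, h, hk⟩
    have hg : P.Guard (σ T) := h.guard.1 (by simpa [Test.Holds, Expr.eval] using hb)
    refine (runs_iteration h hg).mono (by omega) fun m'' ⟨τ, hτ⟩ => ?_
    have := hτ.run.le_card
    exact ⟨k - 1, by omega, T + 1, τ, hτ, by omega⟩
  · have : 2150 * P.size ^ 2 + (Test.le (.reg 10) (.lit 0)).time + 1 ≤ 2160 * P.size ^ 2 := by
      simp only [Test.time, Expr.time]
      omega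
    calc (P.edges.card + 1) * _ ≤ P.size * (2160 * P.size ^ 2) :=
          Nat.mul_le_mul (by omega) this
      _ = 2160 * P.size ^ 3 := by ring
  · rintro m' ⟨⟨k, T, σ, h, -⟩, hb⟩ -
    have hg : ¬ P.Guard (σ T) := fun hg => hb (by
      simp [Test.Holds, Expr.eval, h.guard.2 hg])
    exact (runs_finish h hg).mono (by omega) fun m'' hD => ⟨T, σ, h.run, hg, hD⟩

end Programs

end SCCMatching

theorem theorem4 :
    -- correctness and termination, for every choice of the deleted edges and of the matchings
    (∀ (V : Type*) [Fintype V] [DecidableEq V] (P : SCCMatching.Input V),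
      (∃ s, P.IsStart s) ∧
      ∀ (T : ℕ) (σ : ℕ → SCCMatching.AlgState V), P.IsRun T σ →
        T ≤ P.edges.card ∧
        (P.Guard (σ T) → ∃ s', P.Step (σ T) s') ∧
        (¬ P.Guard (σ T) → ∃ E M, (σ T).best = some (E, M) ∧ P.IsSolution E M)) ∧
    -- cubic time: one program carries out a complete run of the algorithm on every input
    (∃ (p : SCCMatching.Cmd) (c : ℕ), ∀ (n : ℕ) (P : SCCMatching.Input (Fin n)),
      ∃ (t : ℕ) (m : SCCMatching.Memory),
        SCCMatching.Exec p (SCCMatching.load P) t m ∧ t ≤ c * P.size ^ 3 ∧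
        ∃ (T : ℕ) (σ : ℕ → SCCMatching.AlgState (Fin n)),
          P.IsRun T σ ∧ ¬ P.Guard (σ T) ∧ SCCMatching.Documents P m T σ) := by
  refine ⟨fun V _ _ P => ⟨P.exists_isStart, fun T σ h =>
    ⟨h.le_card, h.exists_step, h.exists_solution⟩⟩, SCCMatching.algorithm, 5000, fun n P => ?_⟩
  obtain ⟨t, m, h1, h2, h3⟩ := SCCMatching.runs_algorithm P
  exact ⟨t, m, h1, h2, h3⟩
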